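/- **Definitions.** Let $\mathcal P$ be the space of real polynomials in one variable $x$, $\mathcal P_{\le k}$ the subspace of polynomials of degree at most $k$, let products of linear operators on $\mathcal P$ be compositions, let $\mathsf E$ be the identity operator and $\mathsf F$ the operator of multiplication by $x$. A *polynomial process* is a family of linear maps $\mathsf P_{s,t}:\mathcal P\to\mathcal P$, $0\le s\le t$, such that $\mathsf P_{s,t}(\mathcal P_{\le k})=\mathcal P_{\le k}$ for $k=0,1,\dots$, $\mathsf P_{s,t}(1)=1$, and $\mathsf P_{s,t}\mathsf P_{t,u}=\mathsf P_{s,u}$ for $0\le s\le t\le u$. It is a *quadratic harness* with parameters $\eta,\theta,\sigma,\tau,\gamma$ if $\mathsf P_{s,t}(x)=x$ for $0\le s\le t$ and there is a linear operator $\mathsf X$ on $\mathcal P$ with $\mathsf P_{0,t}\mathsf F=(\mathsf F+t\mathsf X)\mathsf P_{0,t}$ for all $t\ge0$ and $$\mathsf X\mathsf F-\gamma\mathsf F\mathsf X=\mathsf E+\eta\mathsf F+\theta\mathsf X+\sigma\mathsf F^2+\tau\mathsf X^2 .$$ Its infinitesimal generator at $t>0$ is $\mathsf A_t=\lim_{h\to0^+}\frac1h(\mathsf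 P_{t-h,t}-\mathsf E)$, the limit being taken coefficientwise on each polynomial. **Theorem.** Let $\sigma,\tau\ge0$ with $\sigma\tau<1$, and let $\eta,\theta\in\mathbb R$ be such that $1+\alpha\beta>0$, where $$\alpha=\frac{\eta+\theta\sigma}{1-\sigma\tau},\qquad \beta=\frac{\eta\tau+\theta}{1-\sigma\tau}.$$ Let $\gamma=-\sigma\tau$. There is exactly one quadratic harness with the parameters $\eta,\theta,\sigma,\tau,\gamma$. For every $t>0$, the equation $$(z^2+\eta z+\sigma)(t+\tau)\varphi_t(z)^2+\bigl((\theta-t\eta)z-2t\sigma-\sigma\tau-1\bigr)\varphi_t(z)+t\sigma+1=0$$ has a continuous real solution $\varphi_t$, defined for all sufficiently small real $z$, with $\varphi_t(0)=1$. For any such $\varphi_t$ there is a unique probability measure $\nu_t$ on $\mathbb R$ whose (ordinary) moment generating function is $\varphi_t$, that is, such that all moments of $\nu_t$ are finite and $\varphi_t(z)=\sum_{k\ge0}z^k\int y^k\,\nu_t(dy)$ for all sufficiently small real $z$. This measure has compact support, and the generator $\mathsf A_t$ of the quadratic harness exists and is given for every $p\in\mathcal P$ by $$\mathsf A_t(p)(x)=\frac{1+\eta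 x+\sigma x^2}{1+\sigma t}\int\frac{\partial}{\partial x}\left(\frac{p(y)-p(x)}{y-x}\right)\nu_t(dy),$$ where the difference quotient is understood as a polynomial in $x$ and $y$ and the integral converges absolutely. -/

import Mathlib

open Polynomial MeasureTheory Filter Topology

namespace FreeHarness

/-- The linear operators on real polynomials in one variable. Multiplication in this algebra is
composition, so it is the algebra of all sequences `(P 1, P x, P x ^ 2, …)` of polynomials. -/
abbrev PolyOp : Type := Module.End ℝ ℝ[X]

/-- Multiplication by the variable, `p ↦ x p`. -/
noncomputable def opF : PolyOp := LinearMap.mulLeft ℝ (X : ℝ[X])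

/-- Polynomial processes `(P s t)`, `0 ≤ s ≤ t`. (Values of `P` at other pairs play no role.) -/
structure IsPolynomialProcess (P : ℝ → ℝ → PolyOp) : Prop where
  map_degreeLE : ∀ s t : ℝ, 0 ≤ s → s ≤ t → ∀ k : ℕ,
    (degreeLE ℝ (k : WithBot ℕ)).map (P s t) = degreeLE ℝ (k : WithBot ℕ)
  map_one : ∀ s t : ℝ, 0 ≤ s → s ≤ t → P s t 1 = 1
  comp : ∀ s t u : ℝ, 0 ≤ s → s ≤ t → t ≤ u → P s t * P t u = P s u

/-- Quadratic harnesses with parameters `η, θ, σ, τ, γ`: polynomial processes with the martingale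
property, the harness property and the quadratic harness property. -/
structure IsQuadraticHarness (η θ σ τ γ : ℝ) (P : ℝ → ℝ → PolyOp) : Prop
    extends IsPolynomialProcess P where
  martingale : ∀ s t : ℝ, 0 ≤ s → s ≤ t → P s t X = X
  harness : ∃ Z : PolyOp,
    (∀ t : ℝ, 0 ≤ t → P 0 t * opF = (opF + t • Z) * P 0 t) ∧
    Z * opF - γ • (opF * Z) = 1 + η • opF + θ • Z + σ • opF ^ 2 + τ • Z ^ 2

/-- `A` is the (left) infinitesimal generator at time `t`: the limit of `(P (t - h) t - 1) / h`
as `h → 0⁺`, taken in every coefficient of the image of every polynomial. -/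
def IsGenerator (P : ℝ → ℝ → PolyOp) (t : ℝ) (A : PolyOp) : Prop :=
  ∀ (p : ℝ[X]) (n : ℕ),
    Tendsto (fun h : ℝ => (h⁻¹ • (P (t - h) t p - p)).coeff n) (𝓝[>] 0) (𝓝 ((A p).coeff n))

/-- `φ` is, for all small enough `z`, a continuous solution of the quadratic equation
`(z² + η z + σ) (t + τ) φ² + ((θ - t η) z - 2 t σ - σ τ - 1) φ + t σ + 1 = 0`
with `φ 0 = 1`. -/
def IsContinuousSolution (η θ σ τ t : ℝ) (φ : ℝ → ℝ) : Prop :=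
  φ 0 = 1 ∧ ∃ ε > 0, ContinuousOn φ (Set.Ioo (-ε) ε) ∧ ∀ z ∈ Set.Ioo (-ε) ε,
    (z ^ 2 + η * z + σ) * (t + τ) * φ z ^ 2
      + ((θ - t * η) * z - 2 * t * σ - σ * τ - 1) * φ z + t * σ + 1 = 0

/-- `φ` is the (ordinary) moment generating function of `ν`: all moments of `ν` are finite and
`φ z = ∑ₖ (∫ yᵏ ν(dy)) zᵏ` for all small enough `z`. -/
def IsMomentGeneratingFunction (φ : ℝ → ℝ) (ν : Measure ℝ) : Prop :=
  (∀ k : ℕ, Integrable (fun y : ℝ => y ^ k) ν) ∧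
  ∃ ε > 0, ∀ z ∈ Set.Ioo (-ε) ε, HasSum (fun k : ℕ => (∫ y, y ^ k ∂ν) * z ^ k) (φ z)

/-- `∂/∂x ((p(y) - p(x)) / (y - x))`, where the difference quotient, a polynomial in `x` and `y`,
takes the value `p'(y)` on the diagonal `x = y`. -/
noncomputable def derivDiffQuot (p : ℝ[X]) (x y : ℝ) : ℝ :=
  deriv (fun u : ℝ => dslope (fun v : ℝ => p.eval v) y u) x

end FreeHarness

/-!
Let `P t = P 0 t`, let `F` be multiplication by `x` and let `Z` be the operator of the harness
property. Then `P t p = p(F + t Z) 1`, so `Z` determines the process. Applied to `xⁿ`, the quadratic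
harness relation with `γ = -σ τ` determines `Z xⁿ⁺¹` from the values at lower powers, since
`1 - σ τ ≠ 0`; with `Z 1 = 0`, from the martingale property, `Z` is unique.

Conjugating the relation by `P s` shows that `H s = (P s)⁻¹ Z (P s)` satisfies a relation of the same
kind (`CommRel`), again with only one solution that annihilates `1`
(`IsFormalSolution.eq_commutatorOp`). The solution is explicit: if the formal generating function of
a sequence `m` of moments solves the quadratic equation at time `s`, then
`H s p = (1 + η x + σ x²) / (1 + σ s) · L_y[(p(y) - p(x)) / (y - x)]`, where `L` is the functional
with moments `m` (`IsFormalSolution.commRel`). At `s = 0` this operator is `Z`, which gives existence.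
From `P s t F = (F + (t - s) H s) P s t` the generator `A` satisfies `A F = F A + H t`, `A 1 = 0`, and
the operator with the derivative `∂/∂x` under the functional satisfies the same recursion
(`IsQuadraticHarness.isGenerator`).

The moments come from a measure for every `t ≥ 0` (`exists_solution_measure`). The continuous solution
of the quadratic equation is a continued fraction whose coefficients are constant after the first
level, so it generates the moments `⟨e, Tᵏ e⟩` of a bounded Jacobi matrix `T` with real off-diagonal
entries, because `1 + α β > 0`. The matrix acts on `ℓ²(ℕ)` as a finite-rank perturbation of
`b + r (S + S*)`, where `S` is the shift, and its spectral measure at `e` is obtained from the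
continuous functional calculus and the Riesz-Markov-Kakutani theorem. At most exponential growth of the
moments makes the measure unique, through its characteristic function
(`IsMomentGeneratingFunction.measure_eq`).
-/

namespace FreeHarness

/-! ### The difference quotient operator of a moment sequence -/

theorem basisMonomials_apply (n : ℕ) : basisMonomials ℝ n = X ^ n := by
  simp [monomial_one_right_eq_X_pow]

/-- The linear functional on polynomials with moments `L (xᵏ) = mₖ`. -/
noncomputable def momentFunctional (m : ℕ → ℝ) : ℝ[X] →ₗ[ℝ] ℝ :=
  (basisMonomials ℝ).constr ℝ m

theorem momentFunctional_X_pow (m : ℕ → ℝ) (n : ℕ) : momentFunctional m (X ^ n) = m n := by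
  have h := (basisMonomials ℝ).constr_basis ℝ m n
  rwa [basisMonomials_apply] at h

/-- The operator `p ↦ L_y[(p(y) - p(x)) / (y - x)]`, where the functional `L` with moments `m`
acts on the variable `y`. It sends `xⁿ` to `∑ mᵢ xʲ` over `i + j = n - 1`. -/
noncomputable def diffQuotOp (m : ℕ → ℝ) : PolyOp :=
  (basisMonomials ℝ).constr ℝ fun n => ∑ i ∈ Finset.range n, C (m i) * X ^ (n - 1 - i)

theorem diffQuotOp_X_pow (m : ℕ → ℝ) (n : ℕ) :
    diffQuotOp m (X ^ n) = ∑ i ∈ Finset.range n, C (m i) * X ^ (n - 1 - i) := by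
  have h := (basisMonomials ℝ).constr_basis ℝ
    (fun n => ∑ i ∈ Finset.range n, C (m i) * X ^ (n - 1 - i) : ℕ → ℝ[X]) n
  rwa [basisMonomials_apply] at h

theorem diffQuotOp_one (m : ℕ → ℝ) : diffQuotOp m 1 = 0 := by
  simpa using diffQuotOp_X_pow m 0

/-- Two linear maps on polynomials agree if they agree on the powers of the variable. -/
theorem linearMap_ext_X_pow {M : Type*} [AddCommMonoid M] [Module ℝ M] {f g : ℝ[X] →ₗ[ℝ] M}
    (h : ∀ n : ℕ, f (X ^ n) = g (X ^ n)) : f = g :=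
  (basisMonomials ℝ).ext fun n => by
    rw [basisMonomials_apply, h]

theorem diffQuotOp_X_mul (m : ℕ → ℝ) (p : ℝ[X]) :
    diffQuotOp m (X * p) = C (momentFunctional m p) + X * diffQuotOp m p := by
  suffices h : diffQuotOp m ∘ₗ LinearMap.mulLeft ℝ X
      = (monomial 0) ∘ₗ momentFunctional m + LinearMap.mulLeft ℝ X ∘ₗ diffQuotOp m from
    LinearMap.congr_fun h p
  refine linearMap_ext_X_pow fun n => ?_
  simp only [LinearMap.comp_apply, LinearMap.add_apply, LinearMap.mulLeft_apply,
    momentFunctional_X_pow, ← pow_succ', diffQuotOp_X_pow, monomial_zero_left]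
  rw [Finset.sum_range_succ, Finset.mul_sum, add_comm]
  congr 1
  · simp
  · refine Finset.sum_congr rfl fun i hi => ?_
    rw [mul_left_comm, ← pow_succ']
    have := Finset.mem_range.mp hi
    congr 2
    omega

theorem diffQuotOp_C (m : ℕ → ℝ) (a : ℝ) : diffQuotOp m (C a) = 0 := by
  rw [← mul_one (C a), ← smul_eq_C_mul, map_smul, diffQuotOp_one, smul_zero]

theorem momentFunctional_C (m : ℕ → ℝ) (h0 : m 0 = 1) (a : ℝ) : momentFunctional m (C a) = a := by
  have h := momentFunctional_X_pow m 0
  rw [pow_zero, h0] at h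
  rw [← mul_one (C a), ← smul_eq_C_mul, map_smul, h, smul_eq_mul, mul_one]

/-- `diffQuotOp m` lowers the degree by one and preserves the leading coefficient. -/
theorem diffQuotOp_degree (m : ℕ → ℝ) (h0 : m 0 = 1) (n : ℕ) (p : ℝ[X])
    (hp : p.natDegree ≤ n + 1) :
    (diffQuotOp m p).natDegree ≤ n ∧ (diffQuotOp m p).coeff n = p.coeff (n + 1) := by
  have hsplit : ∀ p : ℝ[X], diffQuotOp m p
      = C (momentFunctional m p.divX) + X * diffQuotOp m p.divX := fun p => by
    conv_lhs => rw [← X_mul_divX_add p]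
    rw [map_add, diffQuotOp_C, add_zero, diffQuotOp_X_mul]
  induction n generalizing p with
  | zero =>
    have hd : p.divX = C (p.coeff 1) := by
      rw [eq_C_of_natDegree_le_zero (p := p.divX) (by rw [natDegree_divX_eq_natDegree_tsub_one]; omega)]
      simp [coeff_divX]
    rw [hsplit p, hd, diffQuotOp_C, momentFunctional_C m h0]
    simp
  | succ n ih =>
    obtain ⟨h1, h2⟩ := ih p.divX (by rw [natDegree_divX_eq_natDegree_tsub_one]; omega)
    rw [hsplit p]
    refine ⟨natDegree_add_le_of_degree_le (by simp) ?_, ?_⟩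
    · refine natDegree_mul_le.trans ?_
      rw [natDegree_X]; omega
    · rw [coeff_add, coeff_X_mul, h2, coeff_C_of_ne_zero (by omega), coeff_divX, zero_add]

/-! ### The quadratic equation for moment sequences -/

/-- `m` is normalized and its formal generating function solves the quadratic equation of
`IsContinuousSolution`. -/
structure IsFormalSolution (η θ σ τ t : ℝ) (m : ℕ → ℝ) : Prop where
  zero : m 0 = 1
  quad : (PowerSeries.X ^ 2 + PowerSeries.C η * PowerSeries.X + PowerSeries.C σ)
      * PowerSeries.C (t + τ) * PowerSeries.mk m ^ 2
    + (PowerSeries.C (θ - t * η) * PowerSeries.X - PowerSeries.C (2 * t * σ + σ * τ + 1))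
      * PowerSeries.mk m + PowerSeries.C (t * σ + 1) = 0

/-- The coefficients of the square of the generating function of `m`. -/
noncomputable def convSq (m : ℕ → ℝ) (n : ℕ) : ℝ := PowerSeries.coeff n (PowerSeries.mk m ^ 2)

theorem convSq_eq (m : ℕ → ℝ) (n : ℕ) :
    convSq m n = ∑ i ∈ Finset.range (n + 1), m i * m (n - i) := by
  simp only [convSq, sq, PowerSeries.coeff_mul, PowerSeries.coeff_mk]
  rw [Finset.Nat.sum_antidiagonal_eq_sum_range_succ (fun i j => m i * m j)]

theorem momentFunctional_diffQuotOp (m : ℕ → ℝ) (n : ℕ) :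
    momentFunctional m (diffQuotOp m (X ^ (n + 1))) = convSq m n := by
  rw [diffQuotOp_X_pow, convSq_eq, map_sum]
  refine Finset.sum_congr rfl fun i _ => ?_
  rw [← smul_eq_C_mul, map_smul, momentFunctional_X_pow, smul_eq_mul]
  simp

/-- The recursion for the moments: the coefficients of the quadratic equation. -/
theorem IsFormalSolution.recursion {η θ σ τ t : ℝ} {m : ℕ → ℝ} (h : IsFormalSolution η θ σ τ t m)
    (n : ℕ) : (2 * t * σ + σ * τ + 1) * m (n + 1) = (θ - t * η) * m n
      + (t + τ) * (momentFunctional m (diffQuotOp m (X ^ n)) + η * convSq m n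
        + σ * convSq m (n + 1)) := by
  have h2 : momentFunctional m (diffQuotOp m (X ^ n))
      = PowerSeries.coeff n (PowerSeries.X * PowerSeries.mk m ^ 2) := by
    cases n with
    | zero => simp [diffQuotOp_one]
    | succ k => rw [momentFunctional_diffQuotOp, PowerSeries.coeff_succ_X_mul, convSq]
  have hquad := h.quad
  rw [h2, convSq, convSq]
  generalize t + τ = a, 2 * t * σ + σ * τ + 1 = b, θ - t * η = c, t * σ + 1 = d at hquad ⊢
  have hq : PowerSeries.C a * (PowerSeries.X * (PowerSeries.X * PowerSeries.mk m ^ 2)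
        + PowerSeries.C η * (PowerSeries.X * PowerSeries.mk m ^ 2)
        + PowerSeries.C σ * PowerSeries.mk m ^ 2)
      + PowerSeries.C c * (PowerSeries.X * PowerSeries.mk m)
      - PowerSeries.C b * PowerSeries.mk m + PowerSeries.C d = 0 := by rw [← hquad]; ring
  have hc := congrArg (PowerSeries.coeff (n + 1)) hq
  simp only [map_add, map_sub, PowerSeries.coeff_C_mul, PowerSeries.coeff_succ_X_mul,
    PowerSeries.coeff_mk, map_zero, PowerSeries.coeff_C, Nat.succ_ne_zero, if_false] at hc
  linear_combination -hc

/-! ### The commutation relation -/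

/-- The relation `(1 + σ t) Y F = E + η F + (θ - t η) Y + σ F² - σ (t + τ) F Y
+ (1 + σ t) (t + τ) Y²`, satisfied by the commutator of the generator at time `t` with `F`;
at `t = 0` it is the quadratic harness relation with `γ = -σ τ`. -/
def CommRel (η θ σ τ t : ℝ) (Y : PolyOp) : Prop :=
  (1 + σ * t) • (Y * opF) = 1 + η • opF + (θ - t * η) • Y + σ • opF ^ 2
    - (σ * (t + τ)) • (opF * Y) + ((1 + σ * t) * (t + τ)) • Y ^ 2

/-- The polynomial `1 + η x + σ x²`. -/
noncomputable def quadPoly (η σ : ℝ) : ℝ[X] := 1 + C η * X + C σ * X ^ 2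

/-- The operator `p ↦ (1 + η x + σ x²) / (1 + σ t) · L_y[(p(y) - p(x)) / (y - x)]`, which is the
commutator of the generator at time `t` with multiplication by `x`. -/
noncomputable def commutatorOp (η σ t : ℝ) (m : ℕ → ℝ) : PolyOp :=
  (1 + σ * t)⁻¹ • (LinearMap.mulLeft ℝ (quadPoly η σ) * diffQuotOp m)

theorem commutatorOp_apply (η σ t : ℝ) (m : ℕ → ℝ) (p : ℝ[X]) :
    commutatorOp η σ t m p = C (1 + σ * t)⁻¹ * (quadPoly η σ * diffQuotOp m p) := by
  simp [commutatorOp, smul_eq_C_mul]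

theorem opF_apply (p : ℝ[X]) : opF p = X * p := rfl

theorem opF_sq_apply (p : ℝ[X]) : (opF ^ 2) p = X * (X * p) := rfl

theorem CommRel.apply {η θ σ τ t : ℝ} {Y : PolyOp} (h : CommRel η θ σ τ t Y) (p : ℝ[X]) :
    (1 + σ * t) • Y (X * p) = p + η • (X * p) + (θ - t * η) • Y p + σ • (X * (X * p))
      - (σ * (t + τ)) • (X * Y p) + ((1 + σ * t) * (t + τ)) • Y (Y p) := by
  have := LinearMap.congr_fun h p
  simpa only [LinearMap.add_apply, LinearMap.sub_apply, LinearMap.smul_apply,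
    Module.End.mul_apply, Module.End.one_apply, opF_apply, opF_sq_apply, sq Y] using this

/-- The relation left after cancelling `1 + η x + σ x²`. With `W = diffQuotOp m`, the defect of the
relation at `x p` is `x` times the defect at `p` plus a constant, and the constants at `p = xⁿ`
vanish by the recursion for the moments. -/
theorem IsFormalSolution.diffQuotOp_relation {η θ σ τ t : ℝ} {m : ℕ → ℝ}
    (h : IsFormalSolution η θ σ τ t m) (n : ℕ) :
    C (1 + σ * t) * diffQuotOp m (X * X ^ n) = C (1 + σ * t) * X ^ n
      + C (θ - t * η) * diffQuotOp m (X ^ n) - C (σ * (t + τ)) * (X * diffQuotOp m (X ^ n))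
      + C (t + τ) * diffQuotOp m (quadPoly η σ * diffQuotOp m (X ^ n)) := by
  have hW1 : momentFunctional m 1 = 1 := by
    simpa [h.zero] using momentFunctional_X_pow m 0
  have hexp : ∀ p : ℝ[X], diffQuotOp m (quadPoly η σ * p)
      = diffQuotOp m p + C η * diffQuotOp m (X * p) + C σ * diffQuotOp m (X * (X * p)) := by
    intro p
    have : quadPoly η σ * p = p + η • (X * p) + σ • (X * (X * p)) := by
      rw [quadPoly, smul_eq_C_mul, smul_eq_C_mul]; ring
    rw [this, map_add, map_add, map_smul, map_smul, smul_eq_C_mul, smul_eq_C_mul]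
  have hLC : ∀ (a : ℝ) (p : ℝ[X]), momentFunctional m (C a * p) = a * momentFunctional m p := by
    intro a p; rw [← smul_eq_C_mul, map_smul, smul_eq_mul]
  have hWC : ∀ (a : ℝ) (p : ℝ[X]), diffQuotOp m (C a * p) = C a * diffQuotOp m p := by
    intro a p; rw [← smul_eq_C_mul, map_smul, smul_eq_C_mul]
  have hX : diffQuotOp m X = 1 := by
    have := diffQuotOp_X_mul m 1
    rwa [mul_one, diffQuotOp_one, hW1, mul_zero, add_zero, map_one] at this
  have hL : momentFunctional m X = m 1 := by simpa using momentFunctional_X_pow m 1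
  induction n with
  | zero => simp [hX, diffQuotOp_one]
  | succ n ih =>
    have hrec := h.recursion n
    have c1 : momentFunctional m (X * diffQuotOp m (X ^ n)) = convSq m n - m n := by
      have := momentFunctional_diffQuotOp m n
      rw [pow_succ', diffQuotOp_X_mul, map_add, momentFunctional_C m h.zero,
        momentFunctional_X_pow] at this
      linear_combination this
    have c2 : momentFunctional m (X * (X * diffQuotOp m (X ^ n)))
        = convSq m (n + 1) - m (n + 1) - m n * m 1 := by
      have := momentFunctional_diffQuotOp m (n + 1)
      rw [pow_succ', diffQuotOp_X_mul, map_add, momentFunctional_C m h.zero,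
        momentFunctional_X_pow, pow_succ', diffQuotOp_X_mul, mul_add, map_add,
        momentFunctional_X_pow, mul_comm X (C (m n)), hLC, hL] at this
      linear_combination this
    have hY : momentFunctional m (X ^ n) = m n := momentFunctional_X_pow m n
    have hXY : momentFunctional m (X * X ^ n) = m (n + 1) := by
      rw [← pow_succ', momentFunctional_X_pow]
    have hrec' := congrArg (C : ℝ → ℝ[X]) hrec
    rw [hexp] at ih ⊢
    rw [pow_succ']
    generalize (X : ℝ[X]) ^ n = Y at *
    have hXC : ∀ a : ℝ, diffQuotOp m (X * C a) = C a := by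
      intro a
      rw [mul_comm, hWC, hX, mul_one]
    have hXXC : ∀ a : ℝ, diffQuotOp m (X * (X * C a)) = C a * (C (m 1) + X) := by
      intro a
      rw [diffQuotOp_X_mul, hXC, mul_comm X, hLC, hL, map_mul]; ring
    simp only [diffQuotOp_X_mul m Y, diffQuotOp_X_mul m (X * Y), hY, hXY, mul_add, map_add,
      hXC, hXXC, diffQuotOp_C, zero_add, diffQuotOp_X_mul m (diffQuotOp m Y),
      diffQuotOp_X_mul m (X * diffQuotOp m Y), diffQuotOp_X_mul m (X * (X * diffQuotOp m Y)),
      c1, c2] at ih ⊢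
    simp only [map_add, map_mul, map_sub, map_one, C_ofNat] at ih hrec' ⊢
    linear_combination X * ih + hrec'

/-- The explicit operator solves the commutation relation. -/
theorem IsFormalSolution.commRel {η θ σ τ t : ℝ} {m : ℕ → ℝ} (h : IsFormalSolution η θ σ τ t m)
    (ht : 1 + σ * t ≠ 0) : CommRel η θ σ τ t (commutatorOp η σ t m) := by
  refine linearMap_ext_X_pow fun n => ?_
  have hr := h.diffQuotOp_relation n
  have hinv : (C (1 + σ * t)⁻¹ : ℝ[X]) * C (1 + σ * t) = 1 := by
    rw [← C_mul, inv_mul_cancel₀ ht, C_1]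
  have hcomm : commutatorOp η σ t m (commutatorOp η σ t m (X ^ n))
      = C (1 + σ * t)⁻¹ * (C (1 + σ * t)⁻¹ * (quadPoly η σ
        * diffQuotOp m (quadPoly η σ * diffQuotOp m (X ^ n)))) := by
    rw [commutatorOp_apply _ _ _ _ (X ^ n), ← smul_eq_C_mul, map_smul, commutatorOp_apply,
      smul_eq_C_mul]
  simp only [LinearMap.add_apply, LinearMap.sub_apply, LinearMap.smul_apply, Module.End.mul_apply,
    Module.End.one_apply, opF_apply, opF_sq_apply, sq (commutatorOp η σ t m), hcomm]
  simp only [commutatorOp_apply, smul_eq_C_mul, C_mul (a := 1 + σ * t)]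
  generalize diffQuotOp m (quadPoly η σ * diffQuotOp m (X ^ n)) = U at *
  generalize diffQuotOp m (X * X ^ n) = V at *
  have hq : quadPoly η σ = 1 + C η * X + C σ * X ^ 2 := rfl
  generalize (C (1 + σ * t)⁻¹ : ℝ[X]) = i at *
  generalize (C (1 + σ * t) : ℝ[X]) = c at *
  linear_combination i * quadPoly η σ * hr + X ^ n * hq
    + (quadPoly η σ * X ^ n) * hinv - i * C (t + τ) * quadPoly η σ * U * hinv

/-- Degree and leading coefficient of the explicit operator. -/
theorem commutatorOp_degree {η σ t : ℝ} {m : ℕ → ℝ} (h0 : m 0 = 1) (n : ℕ) (p : ℝ[X])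
    (hp : p.natDegree ≤ n + 1) : (commutatorOp η σ t m p).natDegree ≤ n + 2 ∧
      (commutatorOp η σ t m p).coeff (n + 2) = σ / (1 + σ * t) * p.coeff (n + 1) := by
  obtain ⟨h1, h2⟩ := diffQuotOp_degree m h0 n p hp
  have hexp : commutatorOp η σ t m p = C (1 + σ * t)⁻¹ * (diffQuotOp m p
      + C η * (X * diffQuotOp m p) + C σ * (X * (X * diffQuotOp m p))) := by
    rw [commutatorOp_apply, quadPoly]; ring
  have hq : (quadPoly η σ).natDegree ≤ 2 := by rw [quadPoly]; compute_degree
  constructor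
  · rw [commutatorOp_apply]
    refine (natDegree_C_mul_le _ _).trans (natDegree_mul_le.trans ?_)
    omega
  · rw [hexp]
    simp only [coeff_C_mul, coeff_add, coeff_X_mul, h2]
    rw [coeff_eq_zero_of_natDegree_lt (show _ < n + 2 by omega),
      coeff_eq_zero_of_natDegree_lt (show _ < n + 1 by omega)]
    ring

theorem commutatorOp_C (η σ t : ℝ) (m : ℕ → ℝ) (a : ℝ) : commutatorOp η σ t m (C a) = 0 := by
  rw [commutatorOp_apply, diffQuotOp_C, mul_zero, mul_zero]

/-- The commutation relation has only one solution annihilating the constants: it determines the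
value at `xⁿ⁺¹` by the values at lower powers, because `σ τ ≠ 1`. -/
theorem IsFormalSolution.eq_commutatorOp {η θ σ τ t : ℝ} {m : ℕ → ℝ}
    (h : IsFormalSolution η θ σ τ t m) (ht : 1 + σ * t ≠ 0) (hστ : σ * τ ≠ 1) {Y : PolyOp}
    (hY : CommRel η θ σ τ t Y) (hY1 : Y 1 = 0) : Y = commutatorOp η σ t m := by
  set K := commutatorOp η σ t m with hK
  have hKR : CommRel η θ σ τ t K := h.commRel ht
  have hYC : ∀ a, Y (C a) = 0 := fun a => by
    rw [← mul_one (C a), ← smul_eq_C_mul, map_smul, hY1, smul_zero]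
  -- agreement on all polynomials of degree at most `n`
  have key : ∀ n : ℕ, ∀ p : ℝ[X], p.natDegree ≤ n → Y p = K p := by
    intro n
    induction n with
    | zero =>
      intro p hp
      rw [eq_C_of_natDegree_le_zero hp, hYC, hK, commutatorOp_C]
    | succ n ih =>
      have hstep : ∀ p : ℝ[X], p.natDegree ≤ n →
          (1 + σ * t) • (Y (X * p) - K (X * p))
            = ((1 + σ * t) * (t + τ)) • (Y (K p) - K (K p)) := fun p hp => by
        have e1 := hY.apply p
        have e2 := hKR.apply p
        rw [ih p hp] at e1
        rw [smul_sub, e1, e2, smul_sub]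
        abel
      have hmon : Y (X ^ (n + 1)) = K (X ^ (n + 1)) := by
        have hs := hstep (X ^ n) (natDegree_X_pow_le n)
        rw [← pow_succ'] at hs
        rcases n with _ | n
        · rw [pow_zero, ← C_1, hK, commutatorOp_C, map_zero, map_zero, sub_self, smul_zero] at hs
          exact sub_eq_zero.mp ((smul_eq_zero.mp hs).resolve_left ht)
        · obtain ⟨d1, d2⟩ := commutatorOp_degree (η := η) (σ := σ) (t := t) h.zero n
            (X ^ (n + 1)) (natDegree_X_pow_le _)
          rw [coeff_X_pow_self, mul_one] at d2
          rw [← hK] at d1 d2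
          set c := σ / (1 + σ * t) with hc
          -- the part of `K xⁿ⁺¹` below its leading term
          set r := K (X ^ (n + 1)) - C c * X ^ (n + 2) with hr
          have hrd : r.natDegree ≤ n + 1 := by
            refine natDegree_le_iff_coeff_eq_zero.mpr fun N hN => ?_
            rw [hr, coeff_sub, coeff_C_mul, coeff_X_pow]
            rcases eq_or_lt_of_le (Nat.succ_le_of_lt hN) with h1 | h1
            · have : N = n + 2 := by omega
              subst this
              rw [if_pos rfl, mul_one, d2, sub_self]
            · rw [if_neg (by omega), mul_zero, sub_zero]
              exact coeff_eq_zero_of_natDegree_lt (by omega)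
          have hKr : K (X ^ (n + 1)) = c • X ^ (n + 2) + r := by
            rw [hr, smul_eq_C_mul]; ring
          rw [hKr, map_add, map_add, map_smul, map_smul, ih r hrd, add_sub_add_right_eq_sub,
            ← smul_sub, smul_smul, ← sub_eq_zero, ← sub_smul] at hs
          refine sub_eq_zero.mp ((smul_eq_zero.mp hs).resolve_left ?_)
          have : (1 + σ * t) - (1 + σ * t) * (t + τ) * c = 1 - σ * τ := by
            rw [hc]; field_simp; ring
          rw [this]
          exact sub_ne_zero.mpr hστ.symm
      intro p hp
      have hsplit : p = (p - C (p.coeff (n + 1)) * X ^ (n + 1)) + p.coeff (n + 1) • X ^ (n + 1) := by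
        rw [smul_eq_C_mul]; ring
      have hd : (p - C (p.coeff (n + 1)) * X ^ (n + 1)).natDegree ≤ n := by
        refine natDegree_le_iff_coeff_eq_zero.mpr fun N hN => ?_
        rw [coeff_sub, coeff_C_mul, coeff_X_pow]
        rcases eq_or_lt_of_le (Nat.succ_le_of_lt hN) with h1 | h1
        · subst h1; simp
        · rw [if_neg (by omega), mul_zero, sub_zero]
          exact coeff_eq_zero_of_natDegree_lt (by omega)
      rw [hsplit, map_add, map_add, map_smul, map_smul, ih _ hd, hmon]
  exact LinearMap.ext fun p => key p.natDegree p le_rfl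

/-! ### Spectral measures of bounded self-adjoint operators -/

section Spectral

variable {H : Type*} [NormedAddCommGroup H] [InnerProductSpace ℂ H] [CompleteSpace H]

/-- The positive functional `f ↦ ⟨v, f(T) v⟩` on continuous functions on the spectrum of a
self-adjoint operator `T`, given by the continuous functional calculus. -/
noncomputable def spectralFunctional {T : H →L[ℂ] H} (hT : IsSelfAdjoint T) (v : H) :
    CompactlySupportedContinuousMap (spectrum ℝ T) ℝ →ₚ[ℝ] ℝ :=
  PositiveLinearMap.mk₀
    { toFun := fun f => (inner ℂ v (cfcHom hT (f : C(spectrum ℝ T, ℝ)) v)).re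
      map_add' := fun f g => by
        have : ((f + g : CompactlySupportedContinuousMap (spectrum ℝ T) ℝ) :
            C(spectrum ℝ T, ℝ)) = (f : C(spectrum ℝ T, ℝ)) + (g : C(spectrum ℝ T, ℝ)) := rfl
        rw [this, map_add]
        simp
      map_smul' := fun c f => by
        have : ((c • f : CompactlySupportedContinuousMap (spectrum ℝ T) ℝ) :
            C(spectrum ℝ T, ℝ)) = c • (f : C(spectrum ℝ T, ℝ)) := rfl
        rw [this, map_smul]
        simp only [smul_apply, RingHom.id_apply, smul_eq_mul]
        rw [← Complex.coe_smul, inner_smul_right]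
        simp }
    (fun f hf => by
      -- `⟨v, f(T) v⟩ = ‖√f(T) v‖²`
      let g : C(spectrum ℝ T, ℝ) := ⟨fun x => Real.sqrt (f x), by fun_prop⟩
      have hfg : (f : C(spectrum ℝ T, ℝ)) = star g * g := by
        ext x
        exact (Real.mul_self_sqrt (hf x)).symm
      change 0 ≤ (inner ℂ v (cfcHom hT (f : C(spectrum ℝ T, ℝ)) v)).re
      rw [hfg, map_mul, map_star, mul_apply_eq_comp,
        ContinuousLinearMap.star_eq_adjoint, ContinuousLinearMap.adjoint_inner_right]
      exact inner_self_nonneg (𝕜 := ℂ))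

theorem exists_spectral_measure (T : H →L[ℂ] H) (hT : IsSelfAdjoint T) (v : H) (hv : ‖v‖ = 1) :
    ∃ ν : Measure ℝ, IsProbabilityMeasure ν ∧ (∃ K : Set ℝ, IsCompact K ∧ ν Kᶜ = 0) ∧
      ∀ k : ℕ, ∫ y, y ^ k ∂ν = (inner ℂ v ((T ^ k) v)).re := by
  have : CompactSpace (spectrum ℝ T) := isCompact_iff_compactSpace.mp (spectrum.isCompact T)
  set μ := RealRMK.rieszMeasure (spectralFunctional hT v) with hμ
  have hint : ∀ k : ℕ, ∫ x : spectrum ℝ T, (x : ℝ) ^ k ∂μ = (inner ℂ v ((T ^ k) v)).re := by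
    intro k
    let f : C(spectrum ℝ T, ℝ) := (ContinuousMap.restrict (spectrum ℝ T) (ContinuousMap.id ℝ)) ^ k
    have h := RealRMK.integral_rieszMeasure (spectralFunctional hT v)
      (CompactlySupportedContinuousMap.continuousMapEquiv f)
    have h2 : spectralFunctional hT v (CompactlySupportedContinuousMap.continuousMapEquiv f)
        = (inner ℂ v (cfcHom hT f v)).re := rfl
    rw [h2, show cfcHom hT f = T ^ k by rw [map_pow, cfcHom_id]] at h
    exact h
  have hfin : IsFiniteMeasure μ := inferInstance
  have hmeas : Measurable (Subtype.val : spectrum ℝ T → ℝ) := measurable_subtype_coe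
  have huniv : μ Set.univ = 1 := by
    have h0 := hint 0
    simp only [pow_zero, integral_const, smul_eq_mul, mul_one, one_apply_eq_self,
      inner_self_eq_norm_sq_to_K, hv] at h0
    have h1 : μ.real Set.univ = 1 := by rw [h0]; simp
    rw [Measure.real, ENNReal.toReal_eq_one_iff] at h1
    exact h1
  refine ⟨μ.map Subtype.val, ⟨by rw [Measure.map_apply hmeas MeasurableSet.univ]; simpa⟩,
    ⟨spectrum ℝ T, isCompact_iff_compactSpace.mpr inferInstance, ?_⟩, fun k => ?_⟩
  · rw [Measure.map_apply hmeas (isCompact_iff_compactSpace.mpr inferInstance).measurableSet.compl]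
    have : (Subtype.val : spectrum ℝ T → ℝ) ⁻¹' (spectrum ℝ T)ᶜ = ∅ := by
      ext x; simp
    rw [this, measure_empty]
  · rw [integral_map hmeas.aemeasurable (by fun_prop), hint k]

/-- If `(1 - z T) ψ = v`, the moments `⟨v, Tᵏ v⟩` have the generating function value `⟨v, ψ⟩`
at `z`. -/
theorem hasSum_inner_pow (T : H →L[ℂ] H) (v ψ : H) (z : ℝ) (hz : ‖T‖ * |z| < 1)
    (h : ψ - (z : ℂ) • T ψ = v) :
    HasSum (fun k : ℕ => (inner ℂ v ((T ^ k) v)).re * z ^ k) (inner ℂ v ψ).re := by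
  have hn : ‖(z : ℂ) • T‖ < 1 := by
    rw [norm_smul, Complex.norm_real, Real.norm_eq_abs, mul_comm]; exact hz
  have hs := (summable_geometric_of_norm_lt_one hn).hasSum
  have hinv := geom_series_mul_neg _ hn
  have hψ : (∑' n : ℕ, ((z : ℂ) • T) ^ n) v = ψ := by
    have : (1 - (z : ℂ) • T) ψ = v := by simpa using h
    rw [← this, ← mul_apply_eq_comp, hinv]; rfl
  have h1 := ((ContinuousLinearMap.apply ℂ H v).hasSum hs)
  have h2 := Complex.reCLM.hasSum ((innerSL ℂ v).hasSum h1)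
  simp only [ContinuousLinearMap.apply_apply, hψ, innerSL_apply_apply,
    Complex.reCLM_apply] at h2
  convert h2 using 2 with k
  rw [_root_.smul_pow, smul_apply, inner_smul_right, ← Complex.ofReal_pow,
    Complex.re_ofReal_mul, mul_comm]

end Spectral

/-! ### The unilateral shift -/

/-- The unilateral shift on `ℓ²(ℕ)`: an isometry, together with a unit vector orthogonal to its
range. -/
theorem exists_shift : ∃ (S : lp (fun _ : ℕ => ℂ) 2 →L[ℂ] lp (fun _ : ℕ => ℂ) 2)
    (e : lp (fun _ : ℕ => ℂ) 2), ‖e‖ = 1 ∧ (∀ f g, inner ℂ (S f) (S g) = inner ℂ f g) ∧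
      ∀ f, inner ℂ e (S f) = 0 := by
  have hon : Orthonormal ℂ (fun n : ℕ => (lp.single 2 (n + 1) (1 : ℂ) :
      lp (fun _ : ℕ => ℂ) 2)) := by
    rw [orthonormal_iff_ite]
    intro i j
    rw [lp.inner_single_left]
    by_cases h : i = j
    · subst h; simp
    · simp [lp.single_apply, h]
  refine ⟨hon.orthogonalFamily.linearIsometry.toContinuousLinearMap, lp.single 2 0 (1 : ℂ),
    by simp, fun f g => LinearIsometry.inner_map_map _ f g, fun f => ?_⟩
  have h := (innerSL ℂ (lp.single 2 0 (1 : ℂ) : lp (fun _ : ℕ => ℂ) 2)).hasSum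
    (hon.orthogonalFamily.hasSum_linearIsometry f)
  refine h.unique ?_
  convert hasSum_zero using 2 with n
  simp [lp.inner_single_left, lp.single_apply, LinearIsometry.toSpanSingleton_apply]

/-! ### The moments of a perturbed constant Jacobi matrix -/

/-- The self-adjoint operator with Jacobi matrix whose diagonal is `b₀, b, b, …` and whose
off-diagonal is `r₀, r, r, …`: a finite-rank perturbation of `b + r (S + S*)`. -/
theorem exists_jacobi_operator (b₀ b r₀ r : ℝ) :
    ∃ (T : lp (fun _ : ℕ => ℂ) 2 →L[ℂ] lp (fun _ : ℕ => ℂ) 2) (e : lp (fun _ : ℕ => ℂ) 2),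
      IsSelfAdjoint T ∧ ‖e‖ = 1 ∧ ∀ z u φ : ℝ, |z * r * u| < 1 →
        u * (1 - b * z) = 1 + r ^ 2 * z ^ 2 * u ^ 2 → φ * (1 - b₀ * z - r₀ ^ 2 * z ^ 2 * u) = 1 →
        ∃ ψ, ψ - (z : ℂ) • T ψ = e ∧ (inner ℂ e ψ).re = φ := by
  obtain ⟨S, e, he, hS, heS⟩ := exists_shift
  set S' := ContinuousLinearMap.adjoint S with hS'
  have hee : inner ℂ e e = 1 := by rw [inner_self_eq_norm_sq_to_K, he]; simp
  have hS'S : ∀ f, S' (S f) = f := fun f => by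
    refine ext_inner_left ℂ fun g => ?_
    rw [hS', ContinuousLinearMap.adjoint_inner_right, hS]
  have hS'e : S' e = 0 := by
    refine ext_inner_right ℂ fun g => ?_
    rw [hS', ContinuousLinearMap.adjoint_inner_left, heS, inner_zero_left]
  have hSe : ∀ f, inner ℂ (S f) e = 0 := fun f => by
    rw [← inner_conj_symm, heS, map_zero]
  let T : lp (fun _ : ℕ => ℂ) 2 →L[ℂ] lp (fun _ : ℕ => ℂ) 2 :=
    (b : ℂ) • 1 + (r : ℂ) • (S + S') + ((b₀ - b : ℝ) : ℂ) • InnerProductSpace.rankOne ℂ e e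
      + ((r₀ - r : ℝ) : ℂ) • (InnerProductSpace.rankOne ℂ (S e) e
        + InnerProductSpace.rankOne ℂ e (S e))
  have hTapp : ∀ x, T x = (b : ℂ) • x + (r : ℂ) • (S x + S' x)
      + ((b₀ - b : ℝ) : ℂ) • (inner ℂ e x • e)
      + ((r₀ - r : ℝ) : ℂ) • (inner ℂ e x • S e + inner ℂ (S e) x • e) := fun x => rfl
  refine ⟨T, e, ?_, he, fun z u φ hρ hu hφ => ?_⟩
  · rw [ContinuousLinearMap.isSelfAdjoint_iff']
    simp only [T, map_add, map_smulₛₗ, Complex.conj_ofReal, InnerProductSpace.adjoint_rankOne, hS',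
      ContinuousLinearMap.adjoint_adjoint]
    have h1 : ContinuousLinearMap.adjoint (1 : lp (fun _ : ℕ => ℂ) 2 →L[ℂ] _) = 1 :=
      star_one (lp (fun _ : ℕ => ℂ) 2 →L[ℂ] lp (fun _ : ℕ => ℂ) 2)
    rw [h1, add_comm S, add_comm (InnerProductSpace.rankOne ℂ (S e) e)]
  · set ρ := z * r * u with hρdef
    have hSn : ‖S‖ ≤ 1 := S.opNorm_le_bound zero_le_one fun f => by
      have h := hS f f
      rw [inner_self_eq_norm_sq_to_K, inner_self_eq_norm_sq_to_K] at h
      have h' : ‖S f‖ ^ 2 = ‖f‖ ^ 2 := by exact_mod_cast h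
      rw [one_mul]
      exact ((pow_left_inj₀ (norm_nonneg _) (norm_nonneg _) two_ne_zero).mp h').le
    have hn : ‖(ρ : ℂ) • S‖ < 1 := by
      rw [norm_smul, Complex.norm_real, Real.norm_eq_abs]
      calc |ρ| * ‖S‖ ≤ |ρ| * 1 := by gcongr
        _ < 1 := by simpa using hρ
    -- the geometric vector `χ = ∑ ρⁿ Sⁿ e`
    obtain ⟨χ, hχ⟩ : ∃ χ, χ = e + (ρ : ℂ) • S χ := by
      refine ⟨(∑' n : ℕ, ((ρ : ℂ) • S) ^ n) e, ?_⟩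
      have h := mul_neg_geom_series _ hn
      have h2 := congrArg (fun A : lp (fun _ : ℕ => ℂ) 2 →L[ℂ] _ => A e) h
      simp only [mul_apply_eq_comp, sub_apply, one_apply_eq_self, smul_apply] at h2
      exact eq_add_of_sub_eq h2
    have heχ : inner ℂ e χ = 1 := by
      rw [hχ, inner_add_right, inner_smul_right, heS, hee]; simp
    set κ := r₀ * z * u with hκ
    set x := e + (κ : ℂ) • S χ with hx
    have hex : inner ℂ e x = 1 := by
      rw [hx, inner_add_right, inner_smul_right, heS, hee]; simp
    have hSex : inner ℂ (S e) x = κ := by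
      rw [hx, inner_add_right, inner_smul_right, hSe, hS, heχ]; simp
    have hS'x : S' x = (κ : ℂ) • χ := by
      rw [hx, map_add, map_smul, hS'S, hS'e, zero_add]
    have hTx : T x = ((b₀ + r₀ * κ : ℝ) : ℂ) • e + ((b * κ + r * κ * ρ + r₀ : ℝ) : ℂ) • S χ := by
      have h1 : S χ = S e + (ρ : ℂ) • S (S χ) := by
        conv_lhs => rw [hχ]
        rw [map_add, map_smul]
      have h2 : S e = S χ - (ρ : ℂ) • S (S χ) := eq_sub_of_add_eq h1.symm
      have h3 : S' x = (κ : ℂ) • (e + (ρ : ℂ) • S χ) := by rw [← hχ, hS'x]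
      have h4 : (r * κ : ℂ) = r₀ * ρ := by rw [hκ, hρdef]; push_cast; ring
      rw [hTapp, hex, hSex, h3, hx, map_add, map_smul, h2]
      push_cast
      linear_combination (norm := module) h4 • S (S χ)
    refine ⟨(φ : ℂ) • x, ?_, ?_⟩
    · have e1 : φ * (1 - z * (b₀ + r₀ * κ)) = 1 := by rw [hκ]; linear_combination hφ
      have e2 : κ - z * (b * κ + r * κ * ρ + r₀) = 0 := by
        rw [hκ, hρdef]; linear_combination r₀ * z * hu
      have e1' : (φ : ℂ) * (1 - z * (b₀ + r₀ * κ)) = 1 := by exact_mod_cast e1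
      have e2' : (κ : ℂ) - z * (b * κ + r * κ * ρ + r₀) = 0 := by exact_mod_cast e2
      rw [map_smul, hTx, hx]
      push_cast
      calc _ = ((φ : ℂ) * (1 - z * (b₀ + r₀ * κ))) • e
            + (φ * ((κ : ℂ) - z * (b * κ + r * κ * ρ + r₀))) • S χ := by module
        _ = e := by rw [e1', e2']; simp
    · rw [inner_smul_right, hex]; simp

/-! ### Formal power series and their sums near the origin -/

/-- The formal power series `A` converges to `f` near the origin. -/
def HasLocalSum (A : PowerSeries ℝ) (f : ℝ → ℝ) : Prop :=
  ∀ᶠ z in 𝓝 (0 : ℝ), HasSum (fun k : ℕ => PowerSeries.coeff k A * z ^ k) (f z)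

theorem HasLocalSum.unique {A B : PowerSeries ℝ} {f : ℝ → ℝ} (hA : HasLocalSum A f)
    (hB : HasLocalSum B f) : A = B := by
  have h : ∀ A : PowerSeries ℝ, HasLocalSum A f → HasFPowerSeriesAt f
      (FormalMultilinearSeries.ofScalars ℝ fun k => PowerSeries.coeff k A) 0 := fun A hA => by
    rw [hasFPowerSeriesAt_iff]
    filter_upwards [hA] with z hz
    simpa [FormalMultilinearSeries.coeff_ofScalars, mul_comm] using hz
  ext k
  have := congrArg (fun p => p.coeff k)
    ((h A hA).eq_formalMultilinearSeries (h B hB))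
  simpa [FormalMultilinearSeries.coeff_ofScalars] using this

theorem HasLocalSum.add {A B : PowerSeries ℝ} {f g : ℝ → ℝ} (hA : HasLocalSum A f)
    (hB : HasLocalSum B g) : HasLocalSum (A + B) (fun z => f z + g z) := by
  filter_upwards [hA, hB] with z h1 h2
  simpa [add_mul] using h1.add h2

theorem HasLocalSum.mul {A B : PowerSeries ℝ} {f g : ℝ → ℝ} (hA : HasLocalSum A f)
    (hB : HasLocalSum B g) : HasLocalSum (A * B) (fun z => f z * g z) := by
  filter_upwards [hA, hB] with z h1 h2
  have hs := summable_norm_sum_mul_antidiagonal_of_summable_norm h1.summable.norm h2.summable.norm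
  have he := tsum_mul_tsum_eq_tsum_sum_antidiagonal_of_summable_norm h1.summable.norm
    h2.summable.norm
  rw [h1.tsum_eq, h2.tsum_eq] at he
  rw [he]
  refine (congrArg (fun F : ℕ → ℝ => HasSum F _) (funext fun k => ?_)).mpr hs.of_norm.hasSum
  rw [PowerSeries.coeff_mul, Finset.sum_mul]
  refine Finset.sum_congr rfl fun ij hij => ?_
  rw [← Finset.HasAntidiagonal.mem_antidiagonal.mp hij, pow_add]
  ring

theorem HasLocalSum.C (c : ℝ) : HasLocalSum (PowerSeries.C c) (fun _ => c) := by
  refine Eventually.of_forall fun z => ?_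
  convert hasSum_ite_eq 0 c using 2 with k
  rw [PowerSeries.coeff_C]
  split_ifs with h <;> simp [h]

theorem HasLocalSum.X : HasLocalSum PowerSeries.X (fun z => z) := by
  refine Eventually.of_forall fun z => ?_
  convert hasSum_ite_eq 1 z using 2 with k
  rw [PowerSeries.coeff_X]
  split_ifs with h <;> simp [h]

theorem HasLocalSum.congr {A : PowerSeries ℝ} {f g : ℝ → ℝ} (hA : HasLocalSum A f)
    (hfg : f =ᶠ[𝓝 0] g) : HasLocalSum A g := by
  filter_upwards [hA, hfg] with z h1 h2
  rwa [← h2]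

theorem eventually_of_Ioo {p : ℝ → Prop} {ε : ℝ} (hε : 0 < ε) (h : ∀ z ∈ Set.Ioo (-ε) ε, p z) :
    ∀ᶠ z in 𝓝 (0 : ℝ), p z :=
  Filter.mem_of_superset (Ioo_mem_nhds (neg_lt_zero.mpr hε) hε) h

theorem exists_Ioo_of_eventually {p : ℝ → Prop} (h : ∀ᶠ z in 𝓝 (0 : ℝ), p z) :
    ∃ ε > 0, ∀ z ∈ Set.Ioo (-ε) ε, p z := by
  obtain ⟨ε, hε, h⟩ := Metric.eventually_nhds_iff.mp h
  exact ⟨ε, hε, fun z hz => h (by rw [Real.dist_eq, sub_zero]; exact abs_lt.mpr hz)⟩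

theorem IsMomentGeneratingFunction.hasLocalSum {φ : ℝ → ℝ} {ν : Measure ℝ}
    (h : IsMomentGeneratingFunction φ ν) :
    HasLocalSum (PowerSeries.mk fun k => ∫ y, y ^ k ∂ν) φ := by
  obtain ⟨-, ε, hε, h⟩ := h
  refine eventually_of_Ioo hε fun z hz => ?_
  simpa using h z hz

/-- The moments form a formal solution if their generating function is a solution. -/
theorem isFormalSolution_of_hasLocalSum {η θ σ τ t : ℝ} {m : ℕ → ℝ} {φ : ℝ → ℝ} (h0 : m 0 = 1)
    (hφ : IsContinuousSolution η θ σ τ t φ) (h : HasLocalSum (PowerSeries.mk m) φ) :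
    IsFormalSolution η θ σ τ t m := by
  refine ⟨h0, ?_⟩
  obtain ⟨-, ε, hε, -, hq⟩ := hφ
  have hX := HasLocalSum.X
  have h1 := ((((hX.mul hX).add ((HasLocalSum.C η).mul hX)).add (HasLocalSum.C σ)).mul
    (HasLocalSum.C (t + τ))).mul (h.mul h)
  have h2 := (((HasLocalSum.C (θ - t * η)).mul hX).add
    (HasLocalSum.C (-(2 * t * σ + σ * τ + 1)))).mul h
  have h3 := (h1.add h2).add (HasLocalSum.C (t * σ + 1))
  have h4 := (h3.congr (g := fun _ => 0) (by
    filter_upwards [eventually_of_Ioo hε hq] with z hz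
    linear_combination hz)).unique (HasLocalSum.C 0)
  rw [map_zero] at h4
  rw [← h4, map_neg]
  ring

/-! ### The continuous solution of the quadratic equation -/

/-- Near the origin, the quadratic equation has only one continuous solution with value `1` at
the origin, since its derivative in the unknown is `σ τ - 1 ≠ 0` there. -/
theorem IsContinuousSolution.eventuallyEq {η θ σ τ t : ℝ} (hστ : σ * τ ≠ 1) {φ ψ : ℝ → ℝ}
    (hφ : IsContinuousSolution η θ σ τ t φ) (hψ : IsContinuousSolution η θ σ τ t ψ) :
    φ =ᶠ[𝓝 0] ψ := by
  obtain ⟨hφ0, ε, hε, hφc, hφq⟩ := hφ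
  obtain ⟨hψ0, δ, hδ, hψc, hψq⟩ := hψ
  have hφ' := hφc.continuousAt (Ioo_mem_nhds (neg_lt_zero.mpr hε) hε)
  have hψ' := hψc.continuousAt (Ioo_mem_nhds (neg_lt_zero.mpr hδ) hδ)
  have hc : ContinuousAt (fun z => (z ^ 2 + η * z + σ) * (t + τ) * (φ z + ψ z)
      + ((θ - t * η) * z - 2 * t * σ - σ * τ - 1)) 0 := by fun_prop
  have hne := hc.eventually_ne (y := 0) (by
    rw [hφ0, hψ0]
    intro h
    exact hστ (by linear_combination h))
  filter_upwards [hne, eventually_of_Ioo hε hφq, eventually_of_Ioo hδ hψq] with z h1 h2 h3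
  refine sub_eq_zero.mp ((mul_eq_zero.mp ?_).resolve_left h1)
  linear_combination h2 - h3

/-- The generating function of a perturbed constant Jacobi matrix: `u` generates the moments of the
constant part, and `φ` is obtained by prepending the first row of the matrix. -/
theorem exists_continued_fraction (b₀ b c₀ c : ℝ) : ∃ u φ : ℝ → ℝ, φ 0 = 1 ∧ ContinuousAt u 0 ∧
    ∀ᶠ z in 𝓝 (0 : ℝ), ContinuousAt φ z ∧ u z * (1 - b * z) = 1 + c * z ^ 2 * u z ^ 2 ∧
      φ z * (1 - b₀ * z - c₀ * z ^ 2 * u z) = 1 := by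
  let s : ℝ → ℝ := fun z => Real.sqrt ((1 - b * z) ^ 2 - 4 * c * z ^ 2)
  let u : ℝ → ℝ := fun z => 2 / ((1 - b * z) + s z)
  have hs : Continuous s := by fun_prop
  have hu : ∀ z, (1 - b * z) + s z ≠ 0 → ContinuousAt u z := fun z hz =>
    ContinuousAt.div (by fun_prop) (by fun_prop) hz
  have hs0 : s 0 = 1 := by simp [s]
  have e1 : ∀ᶠ z in 𝓝 (0 : ℝ), (1 - b * z) + s z ≠ 0 :=
    ContinuousAt.eventually_ne (by fun_prop) (by rw [hs0]; norm_num)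
  have e2 : ∀ᶠ z in 𝓝 (0 : ℝ), 0 < (1 - b * z) ^ 2 - 4 * c * z ^ 2 :=
    ContinuousAt.eventually_lt (by fun_prop) (by fun_prop) (by simp)
  have hu0 : ContinuousAt u 0 := hu 0 e1.self_of_nhds
  have e3 : ∀ᶠ z in 𝓝 (0 : ℝ), 1 - b₀ * z - c₀ * z ^ 2 * u z ≠ 0 :=
    ContinuousAt.eventually_ne (by fun_prop) (by simp)
  refine ⟨u, fun z => 1 / (1 - b₀ * z - c₀ * z ^ 2 * u z), by simp, hu0, ?_⟩
  filter_upwards [e1, e2, e3] with z h1 h2 h3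
  have := hu z h1
  refine ⟨ContinuousAt.div (by fun_prop) (by fun_prop) h3, ?_, one_div_mul_cancel h3⟩
  have hsq : s z ^ 2 = (1 - b * z) ^ 2 - 4 * c * z ^ 2 := Real.sq_sqrt h2.le
  have hu1 : u z * ((1 - b * z) + s z) = 2 := div_mul_cancel₀ _ h1
  -- `u` is a root because `(1 - b z - s) (1 - b z + s) = 4 c z²`
  linear_combination (-(1 / 4) * u z ^ 2) * hsq
    + (1 / 4) * (2 - ((1 - b * z) - s z) * u z) * hu1

/-- A continuous solution exists and is the generating function of the spectral measure of a
Jacobi matrix that is constant from the second row on. The off-diagonal entries are real because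
`1 + α β > 0`; the first row is `(β, √(ℓ (1 - σ τ)))` and the others have diagonal entry
`((1 + t σ) β + (t + τ) α) / (1 - σ τ)` and off-diagonal entry `√(ℓ (1 + t σ))`, where
`ℓ = (t + τ) (1 + α β) / (1 - σ τ)²`. -/
theorem exists_solution_measure {η θ σ τ α β t : ℝ} (hσ : 0 ≤ σ) (hτ : 0 ≤ τ) (hστ : σ * τ < 1)
    (hα : α = (η + θ * σ) / (1 - σ * τ)) (hβ : β = (η * τ + θ) / (1 - σ * τ))
    (hαβ : 0 < 1 + α * β) (ht : 0 ≤ t) :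
    ∃ (φ : ℝ → ℝ) (ν : Measure ℝ), IsContinuousSolution η θ σ τ t φ ∧ IsProbabilityMeasure ν ∧
      (∃ K : Set ℝ, IsCompact K ∧ ν Kᶜ = 0) ∧
      HasLocalSum (PowerSeries.mk fun k => ∫ y, y ^ k ∂ν) φ := by
  have hδ : 0 < 1 - σ * τ := by linarith
  have hδ' := hδ.ne'
  obtain ⟨δ, hδdef⟩ : ∃ δ, δ = 1 - σ * τ := ⟨_, rfl⟩
  have hη : η = α - σ * β := by rw [hα, hβ]; field_simp; ring
  have hθ : θ = β - τ * α := by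
    rw [hα, hβ, mul_div_assoc', ← sub_div, eq_div_iff hδ']; ring
  rw [← hδdef] at hδ hδ'
  set ℓ := (t + τ) * (1 + α * β) / δ ^ 2 with hℓ
  have hℓ' : δ ^ 2 * ℓ = (t + τ) * (1 + α * β) := by rw [hℓ]; field_simp
  have hℓ0 : 0 ≤ ℓ := by positivity
  set b := ((1 + t * σ) * β + (t + τ) * α) / δ with hb
  have hb' : δ * b = (1 + t * σ) * β + (t + τ) * α := by rw [hb]; field_simp
  set r₀ := Real.sqrt (ℓ * δ) with hr₀
  set r := Real.sqrt (ℓ * (1 + t * σ)) with hr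
  have hr₀2 : r₀ ^ 2 = ℓ * δ := Real.sq_sqrt (by positivity)
  have hr2 : r ^ 2 = ℓ * (1 + t * σ) := Real.sq_sqrt (by positivity)
  obtain ⟨u, φ, hφ0, hu, hev⟩ := exists_continued_fraction β b (r₀ ^ 2) (r ^ 2)
  obtain ⟨T, e, hT, he, hsol⟩ := exists_jacobi_operator β b r₀ r
  obtain ⟨ν, hν, hK, hmom⟩ := exists_spectral_measure T hT e he
  refine ⟨φ, ν, ⟨hφ0, ?_⟩, hν, hK, ?_⟩
  · obtain ⟨ε, hε, h⟩ := exists_Ioo_of_eventually hev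
    refine ⟨ε, hε, fun z hz => (h z hz).1.continuousWithinAt, fun z hz => ?_⟩
    obtain ⟨-, hu, hφ⟩ := h z hz
    rw [hr2] at hu
    rw [hr₀2] at hφ
    obtain ⟨g, hg⟩ : ∃ g, g = 1 - β * z - ℓ * δ * z ^ 2 * u z := ⟨_, rfl⟩
    rw [← hg] at hφ
    -- the equation for `g = 1 / φ`: eliminate `u` between its equation and the definition of `g`
    have key : (z ^ 2 + η * z + σ) * (t + τ) + ((θ - t * η) * z - 2 * t * σ - σ * τ - 1) * g
        + (t * σ + 1) * g ^ 2 = 0 := by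
      have h1 : (1 - β * z - g) * (δ - (δ * b) * z)
          = δ ^ 2 * ℓ * z ^ 2 + (1 + t * σ) * (1 - β * z - g) ^ 2 := by
        rw [hg]; linear_combination δ ^ 2 * ℓ * z ^ 2 * hu
      rw [hℓ', hb', hδdef] at h1
      rw [hη, hθ]
      linear_combination -h1
    linear_combination φ z ^ 2 * key - ((((θ - t * η) * z - 2 * t * σ - σ * τ - 1)) * φ z
      + (t * σ + 1) * (φ z * g + 1)) * hφ
  · have h1 : ∀ᶠ z in 𝓝 (0 : ℝ), |z * r * u z| < 1 :=
      ContinuousAt.eventually_lt (by fun_prop) (by fun_prop) (by simp)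
    have h2 : ∀ᶠ z in 𝓝 (0 : ℝ), ‖T‖ * |z| < 1 :=
      ContinuousAt.eventually_lt (by fun_prop) (by fun_prop) (by simp)
    filter_upwards [h1, h2, hev] with z h1 h2 h3
    obtain ⟨ψ, hψ, hψφ⟩ := hsol z (u z) (φ z) h1 (by linear_combination h3.2.1) h3.2.2
    have := hasSum_inner_pow T e ψ z h2 hψ
    rw [hψφ] at this
    simpa only [PowerSeries.coeff_mk, hmom] using this

/-! ### Uniqueness of the measure -/

/-- Characteristic function of a measure whose absolute moments grow at most exponentially. -/
theorem charFun_eq_tsum {ν : Measure ℝ} [IsProbabilityMeasure ν]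
    (hint : ∀ k : ℕ, Integrable (fun y : ℝ => y ^ k) ν) {z : ℝ} (hz : z ≠ 0)
    (hsum : Summable fun k : ℕ => (∫ y, y ^ k ∂ν) * z ^ k) (t : ℝ) :
    charFun ν t = ∑' k : ℕ, (((∫ y, y ^ k ∂ν : ℝ) : ℂ) * ((t * Complex.I) ^ k / k.factorial)) := by
  have hbound : ∀ k : ℕ, ∫ y, ‖y‖ ^ k ∂ν ≤ 1 + ∫ y, y ^ (2 * k) ∂ν := fun k => by
    have h1 : Integrable (fun y : ℝ => 1 + y ^ (2 * k)) ν := (integrable_const 1).add (hint _)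
    calc ∫ y, ‖y‖ ^ k ∂ν ≤ ∫ y, (1 + y ^ (2 * k)) ∂ν := by
          refine integral_mono_of_nonneg (Eventually.of_forall fun y => by positivity) h1
            (Eventually.of_forall fun y => ?_)
          change ‖y‖ ^ k ≤ 1 + y ^ (2 * k)
          have : y ^ (2 * k) = (‖y‖ ^ k) ^ 2 := by
            rw [← pow_mul, mul_comm k 2, pow_mul, pow_mul, Real.norm_eq_abs, sq_abs]
          rw [this]
          nlinarith [sq_nonneg (‖y‖ ^ k - 1)]
      _ = 1 + ∫ y, y ^ (2 * k) ∂ν := by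
          rw [integral_add (integrable_const 1) (hint _)]; simp
  obtain ⟨B, hB⟩ := (hsum.comp_injective (i := fun k : ℕ => 2 * k)
    (fun a b h => by simpa using h)).tendsto_atTop_zero.bddAbove_range
  have hm : ∀ k : ℕ, ∫ y, y ^ (2 * k) ∂ν ≤ B * (1 / z ^ 2) ^ k := fun k => by
    have h : (∫ y, y ^ (2 * k) ∂ν) * z ^ (2 * k) ≤ B := hB ⟨k, rfl⟩
    have hp : 0 < z ^ (2 * k) := by rw [pow_mul]; positivity
    rw [div_pow, one_pow, ← pow_mul, mul_one_div, le_div_iff₀ hp]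
    exact h
  have hF := hasSum_integral_of_summable_integral_norm (μ := ν)
    (F := fun (k : ℕ) (y : ℝ) => ((y ^ k : ℝ) : ℂ) * ((t * Complex.I) ^ k / k.factorial))
    (fun k => ((hint k).ofReal).mul_const _) (by
      refine Summable.of_nonneg_of_le (fun k => by positivity) (fun k => ?_)
        ((Real.summable_pow_div_factorial |t|).add
          ((Real.summable_pow_div_factorial (|t| * (1 / z ^ 2))).mul_left B))
      have : ∀ y : ℝ, ‖((y ^ k : ℝ) : ℂ) * ((t * Complex.I) ^ k / k.factorial)‖
          = ‖y‖ ^ k * (|t| ^ k / k.factorial) := fun y => by simp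
      simp_rw [this]
      rw [integral_mul_const]
      calc (∫ y, ‖y‖ ^ k ∂ν) * (|t| ^ k / k.factorial)
          ≤ (1 + B * (1 / z ^ 2) ^ k) * (|t| ^ k / k.factorial) := by
            gcongr
            exact (hbound k).trans (by gcongr; exact hm k)
        _ = _ := by rw [mul_pow]; ring)
  rw [charFun_apply_real]
  have : ∀ y : ℝ, Complex.exp (t * y * Complex.I)
      = ∑' k : ℕ, ((y ^ k : ℝ) : ℂ) * ((t * Complex.I) ^ k / k.factorial) := fun y => by
    rw [Complex.exp_eq_exp_ℂ, NormedSpace.exp_eq_tsum_div]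
    refine tsum_congr fun k => ?_
    push_cast
    rw [mul_assoc, mul_left_comm, mul_pow, mul_div_assoc]
  simp_rw [this]
  rw [← hF.tsum_eq]
  refine tsum_congr fun k => ?_
  rw [integral_mul_const]
  congr 1
  exact integral_ofReal

theorem IsMomentGeneratingFunction.measure_eq {φ : ℝ → ℝ} {ν ν' : Measure ℝ}
    [IsProbabilityMeasure ν] [IsProbabilityMeasure ν'] (h : IsMomentGeneratingFunction φ ν)
    (h' : IsMomentGeneratingFunction φ ν') : ν' = ν := by
  have hm : ∀ k : ℕ, ∫ y, y ^ k ∂ν = ∫ y, y ^ k ∂ν' := fun k => by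
    simpa using congrArg (PowerSeries.coeff k) (h.hasLocalSum.unique h'.hasLocalSum)
  obtain ⟨hi, ε, hε, hs⟩ := h
  obtain ⟨hi', -⟩ := h'
  have hz : ε / 2 ∈ Set.Ioo (-ε) ε := ⟨by linarith, by linarith⟩
  have hsum := (hs _ hz).summable
  refine Measure.ext_of_charFun (funext fun t => ?_)
  simp_rw [hm] at hsum
  have hz0 : ε / 2 ≠ 0 := by positivity
  rw [charFun_eq_tsum hi hz0 (by simpa only [hm] using hsum), charFun_eq_tsum hi' hz0 hsum]
  simp_rw [hm]

theorem integrable_of_continuous {ν : Measure ℝ} [IsFiniteMeasure ν] {K : Set ℝ} (hK : IsCompact K)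
    (hν : ν Kᶜ = 0) {f : ℝ → ℝ} (hf : Continuous f) : Integrable f ν := by
  have h : IntegrableOn f K ν := hf.continuousOn.integrableOn_compact hK
  rwa [IntegrableOn, Measure.restrict_eq_self_of_ae_mem (show ∀ᵐ x ∂ν, x ∈ K from hν)] at h

/-! ### Polynomial processes generated by an operator -/

/-- The operator `p ↦ p(Y) 1`. -/
noncomputable def evalAtOne (Y : PolyOp) : PolyOp :=
  LinearMap.applyₗ (1 : ℝ[X]) ∘ₗ (aeval Y).toLinearMap

theorem evalAtOne_one (Y : PolyOp) : evalAtOne Y 1 = 1 := by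
  simp [evalAtOne]

theorem evalAtOne_X_mul (Y : PolyOp) (p : ℝ[X]) : evalAtOne Y (X * p) = Y (evalAtOne Y p) := by
  simp [evalAtOne]

/-- An operator intertwining multiplication by `x` with `Y` and fixing `1` is `evalAtOne Y`. -/
theorem eq_evalAtOne {Y Q : PolyOp} (h1 : Q 1 = 1) (h : ∀ p, Q (X * p) = Y (Q p)) :
    Q = evalAtOne Y := by
  refine linearMap_ext_X_pow fun n => ?_
  induction n with
  | zero => rw [pow_zero, h1, evalAtOne_one]
  | succ n ih => rw [pow_succ', h, evalAtOne_X_mul, ih]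

/-- `p ↦ p(F + t Z) 1` is triangular with nonzero diagonal when `Z` is the solution of the
commutation relation at `t = 0`. -/
theorem degree_evalAtOne {η σ t : ℝ} (hσ : 0 ≤ σ) (ht : 0 ≤ t) {m : ℕ → ℝ} (h0 : m 0 = 1) (n : ℕ) :
    (evalAtOne (opF + t • commutatorOp η σ 0 m) (X ^ n)).degree = n := by
  induction n with
  | zero => rw [pow_zero, evalAtOne_one, degree_one]; rfl
  | succ n ih =>
    rw [pow_succ', evalAtOne_X_mul]
    set p := evalAtOne (opF + t • commutatorOp η σ 0 m) (X ^ n) with hp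
    have hd : p.natDegree = n := natDegree_eq_of_degree_eq_some ih
    have hp0 : p ≠ 0 := fun h => by simp [h] at ih
    have hlc : p.coeff n ≠ 0 := by rw [← hd]; exact leadingCoeff_ne_zero.mpr hp0
    rw [LinearMap.add_apply, LinearMap.smul_apply, opF_apply]
    rcases n with _ | n
    · have hc : p = C (p.coeff 0) := eq_C_of_natDegree_le_zero hd.le
      rw [hc, commutatorOp_C, smul_zero, add_zero, mul_comm, degree_C_mul_X hlc]
      rfl
    · obtain ⟨d1, d2⟩ := commutatorOp_degree (η := η) (σ := σ) (t := 0) h0 n p hd.le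
      refine degree_eq_of_le_of_coeff_ne_zero ?_ ?_
      · refine (degree_add_le_of_degree_le ?_ ?_)
        · refine degree_le_of_natDegree_le ?_
          rw [natDegree_X_mul hp0]; omega
        · refine (degree_smul_le _ _).trans (degree_le_of_natDegree_le ?_)
          exact d1
      · rw [coeff_add, coeff_X_mul, coeff_smul, d2, smul_eq_mul]
        have : p.coeff (n + 1) + t * (σ / (1 + σ * 0) * p.coeff (n + 1))
            = (1 + t * σ) * p.coeff (n + 1) := by
          rw [mul_zero, add_zero, div_one]; ring
        rw [this]
        exact mul_ne_zero (by positivity) hlc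

/-- An operator mapping `xⁿ` to a polynomial of degree `n` is bijective, and so are its
restrictions to the polynomials of bounded degree. -/
theorem exists_linearEquiv_of_degree {Q : PolyOp} (h : ∀ n : ℕ, (Q (X ^ n)).degree = n) :
    ∃ E : ℝ[X] ≃ₗ[ℝ] ℝ[X], (∀ p, E p = Q p) ∧
      ∀ k : ℕ, (degreeLE ℝ (k : WithBot ℕ)).map Q = degreeLE ℝ (k : WithBot ℕ) := by
  let S : Polynomial.Sequence ℝ := ⟨fun n => Q (X ^ n), h⟩
  let M : Polynomial.Sequence ℝ := ⟨fun n => X ^ n, fun n => degree_X_pow n⟩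
  have hS : ∀ i, IsUnit (S i).leadingCoeff := fun i =>
    (leadingCoeff_ne_zero.mpr (S.ne_zero i)).isUnit
  have hM : ∀ i, IsUnit (M i).leadingCoeff := fun i =>
    (leadingCoeff_ne_zero.mpr (M.ne_zero i)).isUnit
  refine ⟨(basisMonomials ℝ).equiv (S.basis hS) (Equiv.refl ℕ), fun p => ?_, fun k => ?_⟩
  · suffices h : (((basisMonomials ℝ).equiv (S.basis hS) (Equiv.refl ℕ)).toLinearMap : PolyOp) = Q
      from LinearMap.congr_fun h p
    refine (basisMonomials ℝ).ext fun n => ?_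
    rw [LinearEquiv.coe_coe, Module.Basis.equiv_apply, basisMonomials_apply,
      Polynomial.Sequence.basis_eq_self]
    rfl
  · refine Eq.trans ?_ (S.span_degreeLE (m := k) fun i _ => hS i)
    rw [← M.span_degreeLE (m := k) fun i _ => hM i, Submodule.map_span, Set.image_image]

/-! ### Existence and uniqueness of the quadratic harness -/

/-- The quadratic harness relation with `γ = -σ τ` is the commutation relation at `t = 0`. -/
theorem commRel_zero_iff {η θ σ τ γ : ℝ} (hγ : γ = -(σ * τ)) {Z : PolyOp} :
    Z * opF - γ • (opF * Z) = 1 + η • opF + θ • Z + σ • opF ^ 2 + τ • Z ^ 2 ↔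
      CommRel η θ σ τ 0 Z := by
  rw [CommRel, hγ, ← sub_eq_zero, ← sub_eq_zero (a := (1 + σ * 0) • (Z * opF))]
  have : Z * opF - (-(σ * τ)) • (opF * Z) - (1 + η • opF + θ • Z + σ • opF ^ 2 + τ • Z ^ 2)
      = (1 + σ * 0) • (Z * opF) - (1 + η • opF + (θ - 0 * η) • Z + σ • opF ^ 2
        - (σ * (0 + τ)) • (opF * Z) + ((1 + σ * 0) * (0 + τ)) • Z ^ 2) := by module
  rw [this]

section Harness

variable {η θ σ τ γ : ℝ} {m : ℝ → ℕ → ℝ} {P : ℝ → ℝ → PolyOp}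

theorem IsQuadraticHarness.zero_eq (hστ : σ * τ < 1) (hγ : γ = -(σ * τ)) {μ : ℕ → ℝ}
    (hμ : IsFormalSolution η θ σ τ 0 μ) (hP : IsQuadraticHarness η θ σ τ γ P) {t : ℝ} (ht : 0 ≤ t) :
    P 0 t = evalAtOne (opF + t • commutatorOp η σ 0 μ) := by
  obtain ⟨Z, hZ, hrel⟩ := hP.harness
  have hZX : ∀ t, 0 ≤ t → ∀ p, P 0 t (X * p) = (opF + t • Z) (P 0 t p) := fun t ht p =>
    LinearMap.congr_fun (hZ t ht) p
  have hZ1 : Z 1 = 0 := by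
    have h := hZX 1 zero_le_one 1
    rw [hP.map_one 0 1 le_rfl zero_le_one, mul_one, hP.martingale 0 1 le_rfl zero_le_one, one_smul,
      LinearMap.add_apply, opF_apply, mul_one] at h
    simpa using h
  have hZeq := hμ.eq_commutatorOp (by simp) hστ.ne ((commRel_zero_iff hγ).mp hrel) hZ1
  rw [← hZeq]
  exact eq_evalAtOne (hP.map_one 0 t le_rfl ht) (hZX t ht)

/-- The marginal operators `P 0 t` of the harness, as linear equivalences. -/
theorem exists_marginals (hσ : 0 ≤ σ) {μ : ℕ → ℝ} (hμ0 : μ 0 = 1) :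
    ∃ E : ℝ → (ℝ[X] ≃ₗ[ℝ] ℝ[X]), ∀ t, 0 ≤ t →
      (∀ p, E t p = evalAtOne (opF + t • commutatorOp η σ 0 μ) p) ∧
      ∀ k : ℕ, (degreeLE ℝ (k : WithBot ℕ)).map (E t).toLinearMap = degreeLE ℝ (k : WithBot ℕ) := by
  have : ∀ t : ℝ, ∃ E : ℝ[X] ≃ₗ[ℝ] ℝ[X], 0 ≤ t →
      (∀ p, E p = evalAtOne (opF + t • commutatorOp η σ 0 μ) p) ∧
      ∀ k : ℕ, (degreeLE ℝ (k : WithBot ℕ)).map E.toLinearMap = degreeLE ℝ (k : WithBot ℕ) := by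
    intro t
    by_cases ht : 0 ≤ t
    · obtain ⟨E, h1, h2⟩ := exists_linearEquiv_of_degree
        (degree_evalAtOne (η := η) hσ ht hμ0)
      refine ⟨E, fun _ => ⟨h1, ?_⟩⟩
      have : E.toLinearMap = evalAtOne (opF + t • commutatorOp η σ 0 μ) := LinearMap.ext h1
      rwa [this]
    · exact ⟨LinearEquiv.refl ℝ _, fun h => absurd h ht⟩
  choose E hE using this
  exact ⟨E, hE⟩

theorem exists_quadraticHarness (hσ : 0 ≤ σ) (hγ : γ = -(σ * τ)) {μ : ℕ → ℝ}
    (hμ : IsFormalSolution η θ σ τ 0 μ) : ∃ P, IsQuadraticHarness η θ σ τ γ P := by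
  obtain ⟨E, hE⟩ := exists_marginals (η := η) hσ hμ.zero
  set Z := commutatorOp η σ 0 μ with hZ
  have hE1 : ∀ t, 0 ≤ t → E t 1 = 1 := fun t ht => by rw [(hE t ht).1, evalAtOne_one]
  have hEX : ∀ t, 0 ≤ t → E t X = X := fun t ht => by
    have := evalAtOne_X_mul (opF + t • Z) 1
    rw [mul_one, evalAtOne_one, LinearMap.add_apply, LinearMap.smul_apply, hZ, ← C_1,
      commutatorOp_C, smul_zero, add_zero, opF_apply, C_1, mul_one] at this
    rw [(hE t ht).1, this]
  have hE0 : ∀ p, E 0 p = p := fun p => by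
    have : evalAtOne (opF + (0 : ℝ) • Z) = 1 :=
      (eq_evalAtOne rfl fun p => by simp [opF_apply]).symm
    rw [(hE 0 le_rfl).1, this, Module.End.one_apply]
  have hE0' : ∀ p, (E 0).symm p = p := fun p => by rw [LinearEquiv.symm_apply_eq, hE0]
  refine ⟨fun s t => (E s).symm.toLinearMap ∘ₗ (E t).toLinearMap, ⟨?_, ?_, ?_⟩, ?_, ⟨Z, ?_, ?_⟩⟩
  · intro s t hs hst k
    rw [Submodule.map_comp, (hE t (hs.trans hst)).2 k]
    conv_lhs => rw [← (hE s hs).2 k]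
    rw [← Submodule.map_comp]
    simp
  · intro s t hs hst
    simp only [LinearMap.comp_apply, LinearEquiv.coe_coe]
    rw [hE1 t (hs.trans hst), LinearEquiv.symm_apply_eq, hE1 s hs]
  · intro s t u hs hst htu
    refine LinearMap.ext fun p => ?_
    simp
  · intro s t hs hst
    simp only [LinearMap.comp_apply, LinearEquiv.coe_coe]
    rw [hEX t (hs.trans hst), LinearEquiv.symm_apply_eq, hEX s hs]
  · intro t ht
    refine LinearMap.ext fun p => ?_
    simp only [Module.End.mul_apply, LinearMap.comp_apply, LinearEquiv.coe_coe, hE0', (hE t ht).1,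
      opF_apply p, evalAtOne_X_mul]
  · exact (commRel_zero_iff hγ).mpr (hμ.commRel (by simp))

theorem IsQuadraticHarness.marginal_apply (hστ : σ * τ < 1) (hγ : γ = -(σ * τ)) {μ : ℕ → ℝ}
    (hμ : IsFormalSolution η θ σ τ 0 μ) (hP : IsQuadraticHarness η θ σ τ γ P)
    {E : ℝ → (ℝ[X] ≃ₗ[ℝ] ℝ[X])}
    (hE : ∀ t, 0 ≤ t → ∀ p, E t p = evalAtOne (opF + t • commutatorOp η σ 0 μ) p)
    {s t : ℝ} (hs : 0 ≤ s) (hst : s ≤ t) (p : ℝ[X]) : E s (P s t p) = E t p := by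
  rw [hE s hs, hE t (hs.trans hst), ← hP.zero_eq hστ hγ hμ hs, ← hP.zero_eq hστ hγ hμ (hs.trans hst),
    ← hP.comp 0 s t le_rfl hs hst]
  rfl

theorem IsQuadraticHarness.eq (hσ : 0 ≤ σ) (hστ : σ * τ < 1) (hγ : γ = -(σ * τ)) {μ : ℕ → ℝ}
    (hμ : IsFormalSolution η θ σ τ 0 μ) {P' : ℝ → ℝ → PolyOp}
    (hP : IsQuadraticHarness η θ σ τ γ P) (hP' : IsQuadraticHarness η θ σ τ γ P') {s t : ℝ}
    (hs : 0 ≤ s) (hst : s ≤ t) : P s t = P' s t := by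
  obtain ⟨E, hE⟩ := exists_marginals (η := η) hσ hμ.zero
  refine LinearMap.ext fun p => (E s).injective ?_
  rw [hP.marginal_apply hστ hγ hμ (fun t ht => (hE t ht).1) hs hst,
    hP'.marginal_apply hστ hγ hμ (fun t ht => (hE t ht).1) hs hst]

/-- The intertwining relation `P s t F = (F + (t - s) H s) P s t` with the explicit operator `H s`:
conjugating the relation of the harness by `P 0 s` gives the commutation relation at `s`, which has
only one solution. -/
theorem IsQuadraticHarness.apply_X_mul (hσ : 0 ≤ σ) (hστ : σ * τ < 1) (hγ : γ = -(σ * τ))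
    (hm : ∀ t, 0 ≤ t → IsFormalSolution η θ σ τ t (m t)) (hP : IsQuadraticHarness η θ σ τ γ P)
    {s t : ℝ} (hs : 0 ≤ s) (hst : s ≤ t) (p : ℝ[X]) :
    P s t (X * p) = X * P s t p + (t - s) • commutatorOp η σ s (m s) (P s t p) := by
  have hμ := hm 0 le_rfl
  obtain ⟨E, hE⟩ := exists_marginals (η := η) hσ hμ.zero
  have hPE : ∀ q, E s (P s t q) = E t q :=
    hP.marginal_apply hστ hγ hμ (fun t ht => (hE t ht).1) hs hst
  set Z := commutatorOp η σ 0 (m 0) with hZ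
  have hEX : ∀ t, 0 ≤ t → ∀ q, E t (X * q) = X * E t q + t • Z (E t q) := fun t ht q => by
    rw [(hE t ht).1, (hE t ht).1, evalAtOne_X_mul]; rfl
  let Y : PolyOp := (E s).symm.toLinearMap ∘ₗ Z ∘ₗ (E s).toLinearMap
  have hEY : ∀ q, E s (Y q) = Z (E s q) := fun q => by simp [Y]
  have hYrel : CommRel η θ σ τ s Y := by
    refine LinearMap.ext fun q => (E s).injective ?_
    have hr := (hμ.commRel (by simp)).apply (E s q)
    simp only [LinearMap.add_apply, LinearMap.sub_apply, LinearMap.smul_apply,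
      Module.End.mul_apply, Module.End.one_apply, opF_apply, opF_sq_apply, sq Y, map_add, map_sub,
      map_smul, hEX s hs, hEY, mul_add, mul_smul_comm]
    rw [← hZ] at hr
    linear_combination (norm := module) hr
  have hY1 : Y 1 = 0 := (E s).injective (by
    rw [hEY, (hE s hs).1, evalAtOne_one, hZ, ← C_1, commutatorOp_C, map_zero])
  rw [← (hm s hs).eq_commutatorOp (by positivity) hστ.ne hYrel hY1]
  refine (E s).injective ?_
  rw [hPE, map_add, map_smul, hEY, hEX s hs, hEX t (hs.trans hst), hPE]
  module

end Harness

/-! ### Coefficientwise convergence -/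

/-- Convergence of all coefficients, with degrees eventually bounded. -/
structure CoeffTendsto {ι : Type*} (l : Filter ι) (f : ι → ℝ[X]) (g : ℝ[X]) : Prop where
  bounded : ∃ N : ℕ, ∀ᶠ i in l, (f i).natDegree ≤ N
  tendsto : ∀ k : ℕ, Tendsto (fun i => (f i).coeff k) l (𝓝 (g.coeff k))

section Coeff

variable {ι : Type*} {l : Filter ι} {f f' : ι → ℝ[X]} {g g' : ℝ[X]}

theorem CoeffTendsto.congr (h : CoeffTendsto l f g) (he : ∀ᶠ i in l, f i = f' i) :
    CoeffTendsto l f' g := by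
  obtain ⟨N, hN⟩ := h.bounded
  exact ⟨⟨N, by filter_upwards [hN, he] with i h1 h2; rwa [← h2]⟩, fun k =>
    (h.tendsto k).congr' (by filter_upwards [he] with i hi; rw [hi])⟩

theorem CoeffTendsto.const (g : ℝ[X]) : CoeffTendsto l (fun _ => g) g :=
  ⟨⟨g.natDegree, Eventually.of_forall fun _ => le_rfl⟩, fun _ => tendsto_const_nhds⟩

theorem CoeffTendsto.add (h : CoeffTendsto l f g) (h' : CoeffTendsto l f' g') :
    CoeffTendsto l (fun i => f i + f' i) (g + g') := by
  obtain ⟨N, hN⟩ := h.bounded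
  obtain ⟨N', hN'⟩ := h'.bounded
  refine ⟨⟨max N N', ?_⟩, fun k => by simpa using (h.tendsto k).add (h'.tendsto k)⟩
  filter_upwards [hN, hN'] with i h1 h2
  exact (natDegree_add_le _ _).trans (max_le_max h1 h2)

theorem CoeffTendsto.X_mul (h : CoeffTendsto l f g) : CoeffTendsto l (fun i => X * f i) (X * g) := by
  obtain ⟨N, hN⟩ := h.bounded
  refine ⟨⟨1 + N, ?_⟩, fun k => ?_⟩
  · filter_upwards [hN] with i h1
    exact natDegree_mul_le.trans (by rw [natDegree_X]; omega)
  · rcases k with _ | k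
    · simpa using tendsto_const_nhds
    · simpa using h.tendsto k

theorem CoeffTendsto.smul {c : ι → ℝ} {a : ℝ} (hc : Tendsto c l (𝓝 a)) (h : CoeffTendsto l f g) :
    CoeffTendsto l (fun i => c i • f i) (a • g) := by
  obtain ⟨N, hN⟩ := h.bounded
  refine ⟨⟨N, ?_⟩, fun k => by simpa using hc.mul (h.tendsto k)⟩
  filter_upwards [hN] with i h1
  exact (natDegree_smul_le _ _).trans h1

theorem CoeffTendsto.sum {κ : Type*} (s : Finset κ) {f : κ → ι → ℝ[X]} {g : κ → ℝ[X]}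
    (h : ∀ j ∈ s, CoeffTendsto l (f j) (g j)) :
    CoeffTendsto l (fun i => ∑ j ∈ s, f j i) (∑ j ∈ s, g j) := by
  classical
  induction s using Finset.induction_on with
  | empty => simpa using CoeffTendsto.const 0
  | insert a s ha ih =>
    simp only [Finset.sum_insert ha]
    exact (h a (Finset.mem_insert_self a s)).add
      (ih fun j hj => h j (Finset.mem_insert_of_mem hj))

/-- Operators that converge on monomials converge along coefficientwise convergent families. -/
theorem CoeffTendsto.map [l.NeBot] {T : ι → PolyOp} {T' : PolyOp}
    (hT : ∀ n : ℕ, CoeffTendsto l (fun i => T i (X ^ n)) (T' (X ^ n))) (h : CoeffTendsto l f g) :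
    CoeffTendsto l (fun i => T i (f i)) (T' g) := by
  obtain ⟨N, hN⟩ := h.bounded
  have hg : g.natDegree ≤ N := natDegree_le_iff_coeff_eq_zero.mpr fun k hk =>
    tendsto_nhds_unique (h.tendsto k) (tendsto_const_nhds.congr' (by
      filter_upwards [hN] with i hi
      rw [coeff_eq_zero_of_natDegree_lt (by omega)]))
  have hexp : ∀ (A : PolyOp) (p : ℝ[X]), p.natDegree ≤ N →
      A p = ∑ n ∈ Finset.range (N + 1), p.coeff n • A (X ^ n) := fun A p hp => by
    conv_lhs => rw [p.as_sum_range' (N + 1) (by omega), map_sum]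
    refine Finset.sum_congr rfl fun n _ => ?_
    rw [← C_mul_X_pow_eq_monomial, ← smul_eq_C_mul, map_smul]
  rw [hexp T' g hg]
  refine (CoeffTendsto.sum _ fun n _ => (hT n).smul (h.tendsto n)).congr ?_
  filter_upwards [hN] with i hi
  rw [hexp (T i) (f i) hi]

end Coeff

/-! ### The generator -/

section Generator

variable {η θ σ τ γ : ℝ} {m : ℝ → ℕ → ℝ} {P : ℝ → ℝ → PolyOp}

/-- The moments depend continuously on the time, by the recursion they satisfy. -/
theorem tendsto_moments {ι : Type*} {l : Filter ι} (hστ : σ * τ < 1)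
    (hm : ∀ t, 0 ≤ t → IsFormalSolution η θ σ τ t (m t)) {s : ι → ℝ} {t : ℝ} (ht : 0 ≤ t)
    (hs : Tendsto s l (𝓝 t)) (hs0 : ∀ᶠ i in l, 0 ≤ s i) (n : ℕ) :
    Tendsto (fun i => m (s i) n) l (𝓝 (m t n)) := by
  induction n using Nat.strong_induction_on with
  | _ n ih =>
    rcases n with _ | n
    · rw [(hm t ht).zero]
      refine tendsto_const_nhds.congr' ?_
      filter_upwards [hs0] with i hi
      rw [(hm _ hi).zero]
    · -- the recursion solved for the highest moment, which also occurs twice in `convSq`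
      have hrec : ∀ t, 0 ≤ t → m t (n + 1) = ((θ - t * η) * m t n
          + (t + τ) * ((if n = 0 then 0 else convSq (m t) (n - 1)) + η * convSq (m t) n
            + σ * ∑ i ∈ Finset.range n, m t (i + 1) * m t (n - i))) / (1 - σ * τ) := by
        intro t ht
        rw [eq_div_iff (by linarith)]
        have h := (hm t ht).recursion n
        have h1 : momentFunctional (m t) (diffQuotOp (m t) (X ^ n))
            = if n = 0 then 0 else convSq (m t) (n - 1) := by
          rcases n with _ | n
          · simp [diffQuotOp_one]
          · rw [momentFunctional_diffQuotOp]; simp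
        have h2 : convSq (m t) (n + 1) = 2 * m t (n + 1)
            + ∑ i ∈ Finset.range n, m t (i + 1) * m t (n - i) := by
          rw [convSq_eq, Finset.sum_range_succ', Finset.sum_range_succ]
          simp only [Nat.reduceSubDiff, Nat.sub_self, Nat.sub_zero, (hm t ht).zero]
          ring
        rw [h1, h2] at h
        linear_combination h
      have hconv : ∀ k ≤ n, Tendsto (fun i => convSq (m (s i)) k) l (𝓝 (convSq (m t) k)) := by
        intro k hk
        simp only [convSq_eq]
        refine tendsto_finsetSum _ fun i hi => ?_
        have := Finset.mem_range.mp hi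
        exact (ih i (by omega)).mul (ih (k - i) (by omega))
      rw [hrec t ht]
      refine Tendsto.congr' (f₁ := fun i => ((θ - s i * η) * m (s i) n
          + (s i + τ) * ((if n = 0 then 0 else convSq (m (s i)) (n - 1)) + η * convSq (m (s i)) n
            + σ * ∑ j ∈ Finset.range n, m (s i) (j + 1) * m (s i) (n - j))) / (1 - σ * τ)) (by
        filter_upwards [hs0] with i hi
        rw [hrec _ hi]) ?_
      have hprev : Tendsto (fun i => if n = 0 then 0 else convSq (m (s i)) (n - 1)) l
          (𝓝 (if n = 0 then 0 else convSq (m t) (n - 1))) := by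
        split_ifs
        · exact tendsto_const_nhds
        · exact hconv _ (by omega)
      have hsum : Tendsto (fun i => ∑ j ∈ Finset.range n, m (s i) (j + 1) * m (s i) (n - j)) l
          (𝓝 (∑ j ∈ Finset.range n, m t (j + 1) * m t (n - j))) := by
        refine tendsto_finsetSum _ fun j hj => ?_
        have := Finset.mem_range.mp hj
        exact (ih (j + 1) (by omega)).mul (ih (n - j) (by omega))
      exact (((tendsto_const_nhds.sub (hs.mul_const _)).mul (ih n (by omega))).add
        ((hs.add_const _).mul ((hprev.add ((hconv n le_rfl).const_mul _)).add
          (hsum.const_mul _)))).div_const _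

theorem coeffTendsto_commutatorOp {ι : Type*} {l : Filter ι} {s : ι → ℝ} {t : ℝ}
    (ht : 1 + σ * t ≠ 0) (hs : Tendsto s l (𝓝 t))
    (hms : ∀ n, Tendsto (fun i => m (s i) n) l (𝓝 (m t n))) (n : ℕ) :
    CoeffTendsto l (fun i => commutatorOp η σ (s i) (m (s i)) (X ^ n))
      (commutatorOp η σ t (m t) (X ^ n)) := by
  have hexp : ∀ (t : ℝ) (μ : ℕ → ℝ) (p : ℝ[X]), commutatorOp η σ t μ p
      = (1 + σ * t)⁻¹ • (diffQuotOp μ p + η • (X * diffQuotOp μ p)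
        + σ • (X * (X * diffQuotOp μ p))) := fun t μ p => by
    rw [commutatorOp_apply, quadPoly]
    simp only [smul_eq_C_mul]
    ring
  have hW : CoeffTendsto l (fun i => diffQuotOp (m (s i)) (X ^ n)) (diffQuotOp (m t) (X ^ n)) := by
    simp only [diffQuotOp_X_pow, ← smul_eq_C_mul]
    exact CoeffTendsto.sum _ fun j _ => (CoeffTendsto.const _).smul (hms j)
  simp only [hexp]
  exact ((hW.add (hW.X_mul.smul tendsto_const_nhds)).add
    (hW.X_mul.X_mul.smul tendsto_const_nhds)).smul
      ((tendsto_const_nhds.add (hs.const_mul σ)).inv₀ ht)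

/-- The operator `p ↦ (1 + η x + σ x²) / (1 + σ t) · L_y[∂/∂x ((p(y) - p(x)) / (y - x))]`. -/
noncomputable def generatorOp (η σ t : ℝ) (μ : ℕ → ℝ) : PolyOp :=
  (1 + σ * t)⁻¹ • (LinearMap.mulLeft ℝ (quadPoly η σ) ∘ₗ derivative ∘ₗ diffQuotOp μ)

theorem generatorOp_apply (η σ t : ℝ) (μ : ℕ → ℝ) (p : ℝ[X]) :
    generatorOp η σ t μ p = (1 + σ * t)⁻¹ • (quadPoly η σ * derivative (diffQuotOp μ p)) := rfl

theorem generatorOp_X_mul (η σ t : ℝ) (μ : ℕ → ℝ) (p : ℝ[X]) :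
    generatorOp η σ t μ (X * p) = X * generatorOp η σ t μ p + commutatorOp η σ t μ p := by
  rw [generatorOp_apply, generatorOp_apply, commutatorOp_apply, diffQuotOp_X_mul]
  simp only [map_add, derivative_C, derivative_mul, derivative_X, smul_eq_C_mul]
  ring

/-- The difference quotients `D h` of the process satisfy
`D h (x p) = x D h p + H (t - h) (P (t - h) t p)`, which in the limit is the recursion
`A F = F A + H` of `generatorOp`. -/
theorem IsQuadraticHarness.isGenerator (hσ : 0 ≤ σ) (hστ : σ * τ < 1) (hγ : γ = -(σ * τ))
    (hm : ∀ t, 0 ≤ t → IsFormalSolution η θ σ τ t (m t)) (hP : IsQuadraticHarness η θ σ τ γ P)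
    {t : ℝ} (ht : 0 < t) : IsGenerator P t (generatorOp η σ t (m t)) := by
  have hh : Tendsto (fun h : ℝ => h) (𝓝[>] 0) (𝓝 0) := tendsto_nhdsWithin_of_tendsto_nhds tendsto_id
  have hs : Tendsto (fun h : ℝ => t - h) (𝓝[>] 0) (𝓝 t) := by
    simpa using tendsto_const_nhds.sub hh
  have hs0 : ∀ᶠ h in 𝓝[>] (0 : ℝ), 0 ≤ t - h :=
    (hs.eventually (lt_mem_nhds ht)).mono fun _ h => le_of_lt h
  have hpos : ∀ᶠ h in 𝓝[>] (0 : ℝ), 0 < h := eventually_mem_nhdsWithin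
  have hK := coeffTendsto_commutatorOp (η := η) (σ := σ) (by positivity) hs
    (tendsto_moments hστ hm ht.le hs hs0)
  have hmon : ∀ n : ℕ, CoeffTendsto (𝓝[>] 0)
      (fun h : ℝ => h⁻¹ • (P (t - h) t (X ^ n) - X ^ n)) (generatorOp η σ t (m t) (X ^ n)) := by
    intro n
    induction n with
    | zero =>
      rw [pow_zero, generatorOp_apply, diffQuotOp_one, map_zero, mul_zero, smul_zero]
      refine (CoeffTendsto.const 0).congr ?_
      filter_upwards [hs0, hpos] with h h1 h2
      rw [hP.map_one _ _ h1 (by linarith), sub_self, smul_zero]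
    | succ n ih =>
      have hR : CoeffTendsto (𝓝[>] 0) (fun h : ℝ => P (t - h) t (X ^ n)) (X ^ n) := by
        have h := (CoeffTendsto.const (X ^ n)).add (ih.smul hh)
        rw [zero_smul, add_zero] at h
        refine h.congr ?_
        filter_upwards [hpos] with h h2
        rw [smul_smul, mul_inv_cancel₀ h2.ne', one_smul, add_sub_cancel]
      rw [pow_succ', generatorOp_X_mul]
      refine (ih.X_mul.add (hR.map hK)).congr ?_
      filter_upwards [hs0, hpos] with h h1 h2
      rw [hP.apply_X_mul hσ hστ hγ hm h1 (by linarith), sub_sub_cancel, mul_smul_comm, mul_sub,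
        ← eq_sub_iff_add_eq', ← smul_sub]
      rw [add_sub_right_comm, add_sub_cancel_left, smul_smul, inv_mul_cancel₀ h2.ne', one_smul]
  intro p
  have hlin : CoeffTendsto (𝓝[>] 0) (fun h : ℝ => (h⁻¹ • (P (t - h) t - 1)) p)
      (generatorOp η σ t (m t) p) :=
    (CoeffTendsto.const p).map (T := fun h : ℝ => h⁻¹ • (P (t - h) t - 1)) hmon
  exact hlin.tendsto

end Generator

/-! ### The integral formula -/

theorem sub_mul_diffQuotOp (y : ℝ) (p : ℝ[X]) :
    (X - C y) * diffQuotOp (fun k => y ^ k) p = p - C (p.eval y) := by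
  suffices h : LinearMap.mulLeft ℝ (X - C y) ∘ₗ diffQuotOp (fun k => y ^ k)
      = LinearMap.id - (monomial 0) ∘ₗ leval y from LinearMap.congr_fun h p
  refine linearMap_ext_X_pow fun n => ?_
  simp only [LinearMap.comp_apply, LinearMap.mulLeft_apply, diffQuotOp_X_pow, LinearMap.sub_apply,
    LinearMap.id_apply, leval_apply, monomial_zero_left, eval_pow, eval_X, map_pow]
  rw [← neg_inj, ← neg_mul, neg_sub, neg_sub, mul_comm]
  rw [← geom_sum₂_mul (C y) X n]

theorem derivDiffQuot_eq (p : ℝ[X]) (x y : ℝ) :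
    derivDiffQuot p x y = (derivative (diffQuotOp (fun k => y ^ k) p)).eval x := by
  have hfun : (fun u : ℝ => dslope (fun v : ℝ => p.eval v) y u)
      = fun u => (diffQuotOp (fun k => y ^ k) p).eval u := by
    funext u
    have h := sub_mul_diffQuotOp y p
    by_cases hu : u = y
    · subst hu
      have h2 := congrArg (fun q => (derivative q).eval u) h
      simp only [derivative_mul, derivative_sub, derivative_X, derivative_C, sub_zero, one_mul,
        eval_add, eval_mul, eval_sub, eval_X, eval_C, sub_self, zero_mul, add_zero] at h2
      rw [dslope_same, Polynomial.deriv, h2]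
    · have h2 := congrArg (fun q => q.eval u) h
      simp only [eval_mul, eval_sub, eval_X, eval_C] at h2
      rw [dslope_of_ne _ hu, slope_def_field, ← h2, mul_div_cancel_left₀ _ (sub_ne_zero.mpr hu)]
  rw [derivDiffQuot, hfun, Polynomial.deriv]

theorem integral_derivDiffQuot {ν : Measure ℝ} (hν : ∀ k : ℕ, Integrable (fun y : ℝ => y ^ k) ν)
    (p : ℝ[X]) (x : ℝ) : Integrable (fun y => derivDiffQuot p x y) ν ∧
      ∫ y, derivDiffQuot p x y ∂ν
        = (derivative (diffQuotOp (fun k => ∫ y, y ^ k ∂ν) p)).eval x := by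
  simp only [derivDiffQuot_eq]
  induction p using Polynomial.induction_on' with
  | add p q hp hq =>
    simp only [map_add, eval_add]
    exact ⟨hp.1.add hq.1, by rw [integral_add hp.1 hq.1, hp.2, hq.2]⟩
  | monomial n a =>
    have hexp : ∀ μ : ℕ → ℝ, (derivative (diffQuotOp μ (monomial n a))).eval x
        = a * ∑ i ∈ Finset.range n, μ i * (derivative (X ^ (n - 1 - i) : ℝ[X])).eval x := by
      intro μ
      rw [← C_mul_X_pow_eq_monomial, ← smul_eq_C_mul, map_smul, diffQuotOp_X_pow, derivative_smul,
        eval_smul, map_sum, eval_finsetSum, smul_eq_mul]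
      congr 1
      refine Finset.sum_congr rfl fun i _ => ?_
      rw [derivative_C_mul, eval_C_mul]
    simp only [hexp]
    have hi : ∀ i ∈ Finset.range n, Integrable
        (fun y : ℝ => y ^ i * (derivative (X ^ (n - 1 - i) : ℝ[X])).eval x) ν :=
      fun i _ => (hν i).mul_const _
    refine ⟨(integrable_finsetSum _ hi).const_mul a, ?_⟩
    rw [integral_const_mul, integral_finsetSum _ hi]
    simp_rw [integral_mul_const]

end FreeHarness

theorem theorem4p1 (η θ σ τ α β γ : ℝ) (hσ : 0 ≤ σ) (hτ : 0 ≤ τ) (hστ : σ * τ < 1)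
    (hα : α = (η + θ * σ) / (1 - σ * τ)) (hβ : β = (η * τ + θ) / (1 - σ * τ))
    (hαβ : 0 < 1 + α * β) (hγ : γ = -(σ * τ)) :
    (∃ P, FreeHarness.IsQuadraticHarness η θ σ τ γ P) ∧
    (∀ P P', FreeHarness.IsQuadraticHarness η θ σ τ γ P →
      FreeHarness.IsQuadraticHarness η θ σ τ γ P' →
      ∀ s t : ℝ, 0 ≤ s → s ≤ t → P s t = P' s t) ∧
    ∀ t : ℝ, 0 < t →
      (∃ φ, FreeHarness.IsContinuousSolution η θ σ τ t φ) ∧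
      ∀ φ : ℝ → ℝ, FreeHarness.IsContinuousSolution η θ σ τ t φ →
        ∃ ν : Measure ℝ,
          IsProbabilityMeasure ν ∧
          (∃ K : Set ℝ, IsCompact K ∧ ν Kᶜ = 0) ∧
          FreeHarness.IsMomentGeneratingFunction φ ν ∧
          (∀ ν' : Measure ℝ, IsProbabilityMeasure ν' →
            FreeHarness.IsMomentGeneratingFunction φ ν' → ν' = ν) ∧
          ∀ P, FreeHarness.IsQuadraticHarness η θ σ τ γ P →
            ∃ A : FreeHarness.PolyOp, FreeHarness.IsGenerator P t A ∧
              ∀ (p : ℝ[X]) (x : ℝ),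
                Integrable (fun y : ℝ => FreeHarness.derivDiffQuot p x y) ν ∧
                (A p).eval x = (1 + η * x + σ * x ^ 2) / (1 + σ * t) *
                  ∫ y, FreeHarness.derivDiffQuot p x y ∂ν := by
  choose! φ₀ ν hφ₀ hν hK hsum using fun (t : ℝ) (ht : 0 ≤ t) =>
    FreeHarness.exists_solution_measure hσ hτ hστ hα hβ hαβ ht
  have hm : ∀ t, 0 ≤ t → FreeHarness.IsFormalSolution η θ σ τ t fun k => ∫ y, y ^ k ∂ν t :=
    fun t ht => by
      have := hν t ht
      exact FreeHarness.isFormalSolution_of_hasLocalSum (by simp) (hφ₀ t ht) (hsum t ht)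
  have hm0 := hm 0 le_rfl
  refine ⟨FreeHarness.exists_quadraticHarness hσ hγ hm0,
    fun P P' hP hP' s t hs hst => hP.eq hσ hστ hγ hm0 hP' hs hst,
    fun t ht => ⟨⟨φ₀ t, hφ₀ t ht.le⟩, fun φ hφ => ?_⟩⟩
  have := hν t ht.le
  obtain ⟨K, hKc, hKν⟩ := hK t ht.le
  have hint : ∀ k : ℕ, Integrable (fun y : ℝ => y ^ k) (ν t) := fun k =>
    FreeHarness.integrable_of_continuous hKc hKν (by fun_prop)
  have hmgf : FreeHarness.IsMomentGeneratingFunction φ (ν t) := by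
    obtain ⟨ε, hε, h⟩ := FreeHarness.exists_Ioo_of_eventually
      ((hsum t ht.le).congr ((hφ₀ t ht.le).eventuallyEq hστ.ne hφ))
    exact ⟨hint, ε, hε, fun z hz => by simpa using h z hz⟩
  refine ⟨ν t, this, ⟨K, hKc, hKν⟩, hmgf, fun ν' hν' h' => hmgf.measure_eq h', fun P hP =>
    ⟨_, hP.isGenerator hσ hστ hγ hm ht, fun p x => ?_⟩⟩
  obtain ⟨hi, he⟩ := FreeHarness.integral_derivDiffQuot hint p x
  refine ⟨hi, ?_⟩
  rw [he, FreeHarness.generatorOp_apply]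
  simp only [FreeHarness.quadPoly, eval_smul, eval_mul, eval_add, eval_one, eval_C, eval_X,
    eval_pow, smul_eq_mul]
  ring
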